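/- Let $\{A_i\}_{i\in I}$ be a finite family of invertible $2\times 2$ real matrices with positive entries, and let $(w_i)_{i\in I}$ be a probability vector with all $w_i>0$. Let $\lambda=\lim_{N\to\infty}\frac1N\log\|A_{i_N}\cdots A_{i_1}\|$ be the top Lyapunov exponent; the limit exists and is constant for almost every sequence $(i_k)_{k\ge1}$ with respect to the Bernoulli measure on $I^{\mathbb N}$ with weights $(w_i)$, and does not depend on the norm. For $A=\begin{pmatrix}p&q\\ s&t\end{pmatrix}$ put $F(A)=\frac12\begin{pmatrix}p-q-s+t&p+q-s-t\\ p-q+s-t&p+q+s+t\end{pmatrix}$, and for $M=\begin{pmatrix}\alpha&\beta\\ \gamma&\delta\end{pmatrix}$ let $[M](x)=\frac{\alpha x+\beta}{\gamma x+\delta}$. Let $f_i=[F(A_i)]$ and $f_i^\top=[F(A_i)^\top]$. Define the sequence $\boldsymbol v=(v_k)_{k\ge0}$ by \[ v_0=\sum_{i\in I}\frac{w_i}{2}\log\frac{\det F(A_i)}{f_i'(0)},\qquad v_k=-\sum_{i\in I}w_i\frac{(-f_i(0))^k}{k}\quad(k\ge1), \] and the infinite matrix $T=(b_{k,n})_{k,n\ge0}$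 by $b_{k,0}=0$ for $k\ge0$, $b_{0,n}=\sum_{i\in I} w_i\,(f_i^\top(0))^n$ for $n\ge1$, and \[ b_{k,n}=\sum_{i\in I}w_i\sum_{\ell=1}^{\min\{k,n\}}\binom n\ell\binom{k-1}{\ell-1}(f_i^\top(0))^{n-\ell}(-f_i(0))^{k-\ell}(f_i'(0))^{\ell}\qquad(k,n\ge1). \] Let $T_m$ be the matrix obtained from $T$ by replacing by $0$ all entries $b_{k,n}$ with $k\ge m$ or $n\ge m$. Take $0<r<1$ such that $f_i([-1,1])\subset[-r,r]$ for all $i\in I$. Let $d_{\mathrm{hyp}}(x,y)=2\,\mathrm{artanh}\left|\frac{x-y}{1-xy}\right|$ for $x,y\in(-1,1)$, let \[ E=\frac1{1-r}\Bigg(\sum_{i\in I}w_i\frac{|f_i^\top(0)|}{1+\sqrt{1-|f_i^\top(0)|^2}}\Bigg)\Bigg(\sum_{i\in I}w_i\,d_{\mathrm{hyp}}(f_i(0),0)\Bigg), \] $C=\max_{i\in I}|f_i^\top(0)|$, $K(r)=\frac1{2\pi}\oint_{|z|=r}\frac{|dz|}{|1-z|}$ and $\rho_m=r^{m-1}K(r)$.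 Then $0\le C<1$; for all natural numbers $n,m\ge2$, \[ \Bigg|\lambda-\sum_{j=0}^{n-1}\big(T_m^{\,j}\boldsymbol v\big)_0\Bigg|\le E\,r^{n-1}+2\left(\log\frac1{1-rC}\right)\frac{(1+\rho_m)^{n-1}-1-(n-1)\rho_m}{\rho_m}+\frac{2(n-1)r^mC^m}{m(1-rC)}; \] and \[ 0<K(r)\le\min\left\{\frac r{\sqrt{1-r^2}},\ \frac{2r}{\pi(1+r)}\left(\frac\pi2+\log\frac{1+r}{1-r}\right)\right\}. \] -/

import Mathlib

open MeasureTheory Filter Topology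

namespace KernelExpansion

noncomputable section

/-- The map `F : GL₂(ℝ) → GL₂(ℝ)` expressing the projective action of `A` in the coordinate
`x ↦ ((1 + x) / 2, (1 - x) / 2)` of the simplex. -/
def F (A : Matrix (Fin 2) (Fin 2) ℝ) : Matrix (Fin 2) (Fin 2) ℝ :=
  (1 / 2 : ℝ) •
    !![A 0 0 - A 0 1 - A 1 0 + A 1 1, A 0 0 + A 0 1 - A 1 0 - A 1 1;
       A 0 0 - A 0 1 + A 1 0 - A 1 1, A 0 0 + A 0 1 + A 1 0 + A 1 1]

/-- The Möbius transformation `[M]`, as a function of a real variable. It depends only on the class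
of `M` in `PGL₂(ℝ)`, and is only evaluated where the denominator is nonzero. -/
def mobius (M : Matrix (Fin 2) (Fin 2) ℝ) (x : ℝ) : ℝ :=
  (M 0 0 * x + M 0 1) / (M 1 0 * x + M 1 1)

/-- The projective map `f_A = [F(A)]`. -/
def proj (A : Matrix (Fin 2) (Fin 2) ℝ) : ℝ → ℝ := mobius (F A)

/-- The transposed projective map `f_A^⊤ = [F(A)^⊤]`. -/
def projT (A : Matrix (Fin 2) (Fin 2) ℝ) : ℝ → ℝ := mobius (F A).transpose

/-- The sequence `v(x; c)`. -/
def basicVec (x c : ℝ) (n : ℕ) : ℝ :=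
  if n = 0 then c else -((-x) ^ n / n)

section Family

variable {I : Type*} [Fintype I]

/-- The initial vector `v = ∑ i, w i • v(f_i(0); (1/2) log (det F(A_i) / f_i'(0)))`. -/
def initVec (A : I → Matrix (Fin 2) (Fin 2) ℝ) (w : I → ℝ) (n : ℕ) : ℝ :=
  ∑ i, w i *
    basicVec (proj (A i) 0) (1 / 2 * Real.log ((F (A i)).det / deriv (proj (A i)) 0)) n

/-- The infinite matrix `T = (b_{k,n})`. -/
def kernelMatrix (A : I → Matrix (Fin 2) (Fin 2) ℝ) (w : I → ℝ) (k n : ℕ) : ℝ :=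
  if n = 0 then 0
  else if k = 0 then ∑ i, w i * projT (A i) 0 ^ n
  else ∑ i, w i * ∑ l ∈ Finset.Icc 1 (min k n),
    (n.choose l : ℝ) * ((k - 1).choose (l - 1) : ℝ) * projT (A i) 0 ^ (n - l) *
      (-proj (A i) 0) ^ (k - l) * deriv (proj (A i)) 0 ^ l

end Family

/-- The truncation `T_m`: the entries with both indices `≤ m - 1` are kept, the others are `0`. -/
def truncate (T : ℕ → ℕ → ℝ) (m k n : ℕ) : ℝ :=
  if k < m ∧ n < m then T k n else 0

/-- The action `(T u)_k = ∑ n, b_{k,n} u_n` of an infinite matrix on a sequence. -/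
def applyMatrix (T : ℕ → ℕ → ℝ) (u : ℕ → ℝ) (k : ℕ) : ℝ :=
  ∑' n, T k n * u n

/-- The hyperbolic distance on `(-1, 1)`. -/
def dHyp (x y : ℝ) : ℝ := 2 * Real.artanh |(x - y) / (1 - x * y)|

/-- `K(r) = (1 / 2π) ∮_{|z| = r} |dz| / |1 - z|`, with `|dz| = r dθ` for `z = r e^{iθ}`. -/
def kernelConst (r : ℝ) : ℝ :=
  1 / (2 * Real.pi) * ∫ θ in (0 : ℝ)..(2 * Real.pi), r / ‖(1 : ℂ) - circleMap 0 r θ‖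

/-- The probability vector `w` as a probability mass function. -/
def weightPMF {I : Type*} [Fintype I] (w : I → ℝ) (hw : ∀ i, 0 < w i) (hw1 : ∑ i, w i = 1) :
    PMF I :=
  PMF.ofFintype (fun i => ENNReal.ofReal (w i)) (by
    rw [← ENNReal.ofReal_sum_of_nonneg (fun i _ => (hw i).le), hw1, ENNReal.ofReal_one])

/-- The Bernoulli measure on `I^ℕ` with weights `w`. -/
def bernoulliMeasure {I : Type*} [Fintype I] [MeasurableSpace I]
    (w : I → ℝ) (hw : ∀ i, 0 < w i) (hw1 : ∑ i, w i = 1) : Measure (ℕ → I) :=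
  Measure.infinitePi fun _ : ℕ => (weightPMF w hw hw1).toMeasure

/-- The product `A_{ω (n-1)} ⋯ A_{ω 0}` along a sequence `ω`. -/
def matProd {I : Type*} (A : I → Matrix (Fin 2) (Fin 2) ℝ) (ω : ℕ → I) :
    ℕ → Matrix (Fin 2) (Fin 2) ℝ
  | 0 => 1
  | n + 1 => A (ω n) * matProd A ω n

/-- The entrywise `ℓ¹` norm of a matrix. (Since all norms on the space of `2 × 2` matrices are
equivalent, the Lyapunov exponent does not depend on the norm.) -/
def entryNorm (M : Matrix (Fin 2) (Fin 2) ℝ) : ℝ := ∑ i, ∑ j, |M i j|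

/-- `lam` is the top Lyapunov exponent of the i.i.d. products `A_{i_n} ⋯ A_{i_1}`: for almost every
sequence, `(1 / n) log ‖A_{i_n} ⋯ A_{i_1}‖` converges to `lam`. -/
def IsTopLyapunovExponent {I : Type*} [Fintype I] [MeasurableSpace I]
    (A : I → Matrix (Fin 2) (Fin 2) ℝ) (w : I → ℝ) (hw : ∀ i, 0 < w i) (hw1 : ∑ i, w i = 1)
    (lam : ℝ) : Prop :=
  ∀ᵐ ω ∂(bernoulliMeasure w hw hw1),
    Tendsto (fun n : ℕ => 1 / (n : ℝ) * Real.log (entryNorm (matProd A ω n))) atTop (𝓝 lam)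

/-- The constant `E` controlling the tail of the series. -/
def tailConst {I : Type*} [Fintype I] (A : I → Matrix (Fin 2) (Fin 2) ℝ) (w : I → ℝ) (r : ℝ) : ℝ :=
  1 / (1 - r) *
    (∑ i, w i * (|projT (A i) 0| / (1 + √(1 - |projT (A i) 0| ^ 2)))) *
    (∑ i, w i * dHyp (proj (A i) 0) 0)

/-- `C = max_i |f_i^⊤(0)|` (a supremum over a finite nonempty set). -/
def maxT {I : Type*} (A : I → Matrix (Fin 2) (Fin 2) ℝ) : ℝ := ⨆ i, |projT (A i) 0|

end

end KernelExpansion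

open KernelExpansion

/-! In the coordinate `x` of the simplex each matrix acts by `f_i`. The entry sum of a product is
the mass of the image of the vector `(1,1)`, so `log (entryNorm ..)` is `log 2` plus a Birkhoff sum
of `log (F₁₀ x + F₁₁)` along the random orbit of `0` (`log_entryNorm_matProd`). Put `g(x) = ∑ w_i
log (F(A_i)₁₀ x + F(A_i)₁₁)` and let `P` be the Markov operator `P g = ∑ w_i g ∘ f_i`.

Convergence. By Schwarz–Pick each `f_i` contracts the hyperbolic distance by the factor `r`, and `g`
is Lipschitz for it. Hence `P^k g (0)` converges to some `λ` with error at most `E r^k`. The same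
decay solves the Poisson equation `h = g - λ + P h` with `h` bounded. The Birkhoff sums are then a
martingale with bounded increments plus a bounded term, so `λ` is the Lyapunov exponent
(`exists_isTopLyapunovExponent`).

Duality. Let `ℓ_k` be the Taylor coefficients of `log (1+x)` and `L` the operator `P` on polynomials
followed by truncation to degree below `m`. For the pairing `∑_{1≤k<m} ψ_k y_k / ℓ_k` the matrix
`T_m` is adjoint to `L` (`logPairing_applyMatrix_truncate`). With `φ` the Taylor coefficients of `∑
w_i log (1 + f_i^⊤(0) x)`, this gives `(T_m^{j+1} v)_0 = (L^{j+1} φ)_0 - (L^j φ)_0`. The partial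
sums therefore telescope to `v_0 + (L^{n-1} φ)_0`, an approximation of `P^{n-1} g (0)`.

Truncation. Each `f_i` maps the closed unit disc into the disc of radius `r`. A polynomial bounded
by `M` on the small disc thus has an image under `P` bounded by `M` on the unit disc, and Cauchy's
formula bounds its Taylor tail on the small disc by `M ρ_m`. Iteration gives `M ((1+ρ_m)^j - 1)`.
Cutting the logarithm at degree `m` costs one more term. The resulting bound is stronger than the
one claimed. -/

namespace KernelExpansion

/-! ### The constant `K(r)` -/

lemma sq_norm_one_sub_circleMap (r θ : ℝ) :
    ‖(1 : ℂ) - circleMap 0 r θ‖ ^ 2 = 1 - 2 * r * Real.cos θ + r ^ 2 := by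
  rw [← Complex.normSq_eq_norm_sq, Complex.normSq_apply]
  simp only [circleMap, zero_add, Complex.sub_re, Complex.one_re, Complex.mul_re,
    Complex.ofReal_re, Complex.exp_ofReal_mul_I_re, Complex.ofReal_im, zero_mul, sub_zero,
    Complex.sub_im, Complex.one_im, Complex.mul_im, Complex.exp_ofReal_mul_I_im, add_zero,
    zero_sub]
  linear_combination r ^ 2 * Real.sin_sq_add_cos_sq θ

lemma norm_one_sub_circleMap_pos {r : ℝ} (h0 : 0 < r) (h1 : r < 1) (θ : ℝ) :
    0 < ‖(1 : ℂ) - circleMap 0 r θ‖ := by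
  rw [norm_pos_iff, sub_ne_zero]
  intro h
  have := congrArg norm h
  simp [norm_circleMap_zero, abs_of_pos h0] at this
  linarith

lemma continuous_kernel_integrand {r : ℝ} (h0 : 0 < r) (h1 : r < 1) :
    Continuous fun θ : ℝ => r / ‖(1 : ℂ) - circleMap 0 r θ‖ :=
  continuous_const.div (continuous_const.sub (continuous_circleMap 0 r)).norm
    fun θ => (norm_one_sub_circleMap_pos h0 h1 θ).ne'

lemma kernelConst_pos {r : ℝ} (h0 : 0 < r) (h1 : r < 1) : 0 < kernelConst r := by
  unfold kernelConst
  refine mul_pos (by positivity) (intervalIntegral.intervalIntegral_pos_of_pos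
    ((continuous_kernel_integrand h0 h1).intervalIntegrable _ _) (fun θ => ?_) (by positivity))
  exact div_pos h0 (norm_one_sub_circleMap_pos h0 h1 θ)

/-- The total mass of the Poisson kernel. -/
lemma integral_poissonKernel {r : ℝ} (h0 : 0 < r) (h1 : r < 1) :
    ∫ θ in (0 : ℝ)..(2 * Real.pi), (1 - r ^ 2) / ‖(1 : ℂ) - circleMap 0 r θ‖ ^ 2
      = 2 * Real.pi := by
  have hf : DiffContOnCl ℂ (fun _ : ℂ => (1 : ℂ)) (Metric.ball 0 1) := diffContOnCl_const
  have hw : (r : ℂ) ∈ Metric.ball (0 : ℂ) 1 := by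
    simp [abs_of_pos h0, h1]
  have h := hf.circleAverage_poissonKernel_smul' hw
  rw [Real.circleAverage_def] at h
  have e : ∀ θ : ℝ, ((‖circleMap 0 1 θ - 0‖ ^ 2 - ‖(r : ℂ) - 0‖ ^ 2) /
      ‖(circleMap 0 1 θ - 0) - ((r : ℂ) - 0)‖ ^ 2) • (1 : ℂ)
      = (((1 - r ^ 2) / ‖(1 : ℂ) - circleMap 0 r θ‖ ^ 2 : ℝ) : ℂ) := by
    intro θ
    rw [Complex.real_smul, mul_one, sq_norm_one_sub_circleMap]
    congr 1
    have e2 : ‖(circleMap 0 1 θ - 0) - ((r : ℂ) - 0)‖ ^ 2 = 1 - 2 * r * Real.cos θ + r ^ 2 := by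
      rw [← Complex.normSq_eq_norm_sq, Complex.normSq_apply]
      simp only [circleMap, zero_add, sub_zero, Complex.ofReal_one, one_mul, Complex.sub_re,
        Complex.exp_ofReal_mul_I_re, Complex.ofReal_re, Complex.sub_im,
        Complex.exp_ofReal_mul_I_im, Complex.ofReal_im]
      linear_combination Real.sin_sq_add_cos_sq θ
    rw [e2]
    simp [norm_circleMap_zero]
  simp_rw [e] at h
  rw [intervalIntegral.integral_ofReal, Complex.real_smul, ← Complex.ofReal_mul,
    Complex.ofReal_eq_one] at h
  have hpi : (2 * Real.pi) ≠ 0 := by positivity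
  field_simp at h
  simpa using h

/-- The inequality `2/n ≤ 1/s + s/n²` with `s = √(1 - r²)` replaces `1/n` by a constant plus a
multiple of the Poisson kernel, whose integral is known. -/
lemma kernelConst_le_sqrt {r : ℝ} (h0 : 0 < r) (h1 : r < 1) :
    kernelConst r ≤ r / √(1 - r ^ 2) := by
  have hr2 : 0 < 1 - r ^ 2 := by nlinarith
  set s := √(1 - r ^ 2) with hs
  have hs0 : 0 < s := Real.sqrt_pos.2 hr2
  have hs2 : s ^ 2 = 1 - r ^ 2 := Real.sq_sqrt hr2.le
  have hle : ∫ θ in (0 : ℝ)..(2 * Real.pi), r / ‖(1 : ℂ) - circleMap 0 r θ‖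
      ≤ ∫ θ in (0 : ℝ)..(2 * Real.pi),
        (r / (2 * s) + r / (2 * s) * ((1 - r ^ 2) / ‖(1 : ℂ) - circleMap 0 r θ‖ ^ 2)) := by
    have hc2 : Continuous fun θ : ℝ => (1 - r ^ 2) / ‖(1 : ℂ) - circleMap 0 r θ‖ ^ 2 :=
      continuous_const.div ((continuous_const.sub (continuous_circleMap 0 r)).norm.pow 2)
        fun θ => (pow_pos (norm_one_sub_circleMap_pos h0 h1 θ) 2).ne'
    refine intervalIntegral.integral_mono_on (by positivity)
      ((continuous_kernel_integrand h0 h1).intervalIntegrable _ _)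
      ((continuous_const.add (continuous_const.mul hc2)).intervalIntegrable _ _) fun θ _ => ?_
    have hn := norm_one_sub_circleMap_pos h0 h1 θ
    set n := ‖(1 : ℂ) - circleMap 0 r θ‖
    rw [← hs2, ← sub_nonneg]
    have : r / (2 * s) + r / (2 * s) * (s ^ 2 / n ^ 2) - r / n
        = r / (2 * s) * (1 - s / n) ^ 2 := by
      field_simp
      ring
    rw [this]
    positivity
  have hc2 : Continuous fun θ : ℝ => (1 - r ^ 2) / ‖(1 : ℂ) - circleMap 0 r θ‖ ^ 2 :=
    continuous_const.div ((continuous_const.sub (continuous_circleMap 0 r)).norm.pow 2)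
      fun θ => (pow_pos (norm_one_sub_circleMap_pos h0 h1 θ) 2).ne'
  rw [intervalIntegral.integral_add (by simp) ((hc2.intervalIntegrable _ _).const_mul _),
    intervalIntegral.integral_const_mul, integral_poissonKernel h0 h1,
    intervalIntegral.integral_const, smul_eq_mul] at hle
  unfold kernelConst
  calc 1 / (2 * Real.pi) * ∫ θ in (0 : ℝ)..(2 * Real.pi), r / ‖(1 : ℂ) - circleMap 0 r θ‖
      ≤ 1 / (2 * Real.pi) * ((2 * Real.pi - 0) * (r / (2 * s)) + r / (2 * s) * (2 * Real.pi)) := by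
        gcongr
    _ = r / s := by
        field_simp
        ring

/-- The algebra behind differentiating `log (s + W) - log (1 + s)`: here `s`, `c` are sine and
cosine, `k = 1 - ε²`, and `W` is the square root in the elliptic integrand. -/
lemma ellipticPrimitive_deriv_eq {k s c W : ℝ} (hs : 0 < s) (hc : 0 < c) (hW : 0 < W)
    (hcs : c ^ 2 = 1 - s ^ 2) (hW2 : W ^ 2 = 1 - k * c ^ 2) :
    (c + k * (2 * s * c) / (2 * W)) / (s + W) - c / (1 + s) = 1 / c * (1 / W - 1) := by
  have e1 : (c + k * (2 * s * c) / (2 * W)) / (s + W) = (1 - s * W) / (c * W) := by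
    rw [div_eq_div_iff (by positivity) (by positivity)]
    field_simp
    linear_combination W * hcs + s * hW2
  have e2 : c / (1 + s) = (1 - s) / c := by
    rw [div_eq_div_iff (by positivity) (by positivity)]
    linear_combination hcs
  rw [e1, e2]
  field_simp
  ring

lemma hasDerivAt_ellipticPrimitive {ε : ℝ} (h0 : 0 < ε) (h1 : ε < 1) {x : ℝ}
    (hx : x ∈ Set.Ioo 0 (Real.pi / 2)) :
    HasDerivAt (fun x => Real.log (Real.sin x + √(ε ^ 2 + (1 - ε ^ 2) * Real.sin x ^ 2))
        - Real.log (1 + Real.sin x))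
      (1 / Real.cos x * (1 / √(ε ^ 2 + (1 - ε ^ 2) * Real.sin x ^ 2) - 1)) x := by
  have hc : 0 < Real.cos x := Real.cos_pos_of_mem_Ioo ⟨by linarith [hx.1, Real.pi_pos], hx.2⟩
  have hs : 0 < Real.sin x := Real.sin_pos_of_pos_of_lt_pi hx.1 (by linarith [hx.2, Real.pi_pos])
  have hk : 0 < 1 - ε ^ 2 := by nlinarith
  have hpos : 0 < ε ^ 2 + (1 - ε ^ 2) * Real.sin x ^ 2 := by positivity
  have hW0 := Real.sqrt_pos.2 hpos
  have hW2 := Real.sq_sqrt hpos.le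
  have hcs := Real.sin_sq_add_cos_sq x
  have hsin := Real.hasDerivAt_sin x
  have hW : HasDerivAt (fun x => √(ε ^ 2 + (1 - ε ^ 2) * Real.sin x ^ 2))
      ((1 - ε ^ 2) * (2 * Real.sin x * Real.cos x) /
        (2 * √(ε ^ 2 + (1 - ε ^ 2) * Real.sin x ^ 2))) x :=
    ((((hsin.fun_pow 2).const_mul (1 - ε ^ 2)).const_add (ε ^ 2)).sqrt hpos.ne').congr_deriv
      (by simp)
  have hlog1 := (hsin.fun_add hW).log (by positivity)
  have hlog2 := (hsin.const_add 1).log (by positivity)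
  exact (hlog1.sub hlog2).congr_deriv (ellipticPrimitive_deriv_eq hs hc hW0 (by linarith)
    (by rw [hW2]; linear_combination (1 - ε ^ 2) * hcs))

/-- The integrand minus `1` is nonnegative, so multiplying it by `1 / cos x ≥ 1` only increases it.
The product has an elementary primitive, which equals `0` at `π/2` and `log ε` at `0`. -/
lemma integral_elliptic_le {ε : ℝ} (h0 : 0 < ε) (h1 : ε < 1) :
    ∫ x in (0 : ℝ)..(Real.pi / 2), 1 / √(ε ^ 2 + (1 - ε ^ 2) * Real.sin x ^ 2)
      ≤ Real.pi / 2 + Real.log (1 / ε) := by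
  have hk : 0 < 1 - ε ^ 2 := by nlinarith
  have hpos : ∀ x, 0 < ε ^ 2 + (1 - ε ^ 2) * Real.sin x ^ 2 := fun x => by positivity
  have hsq : Continuous fun x => √(ε ^ 2 + (1 - ε ^ 2) * Real.sin x ^ 2) := by fun_prop
  have hcont : Continuous fun x => 1 / √(ε ^ 2 + (1 - ε ^ 2) * Real.sin x ^ 2) :=
    continuous_const.div hsq fun x => (Real.sqrt_pos.2 (hpos x)).ne'
  have hpi : 0 ≤ Real.pi / 2 := by positivity
  have key := intervalIntegral.integral_le_sub_of_hasDeriv_right_of_le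
    (φ := fun x => 1 / √(ε ^ 2 + (1 - ε ^ 2) * Real.sin x ^ 2) - 1) hpi ?_
    (fun x hx => (hasDerivAt_ellipticPrimitive h0 h1 hx).hasDerivWithinAt)
    ((hcont.sub continuous_const).continuousOn.integrableOn_Icc) ?_
  · rw [intervalIntegral.integral_sub (hcont.intervalIntegrable _ _) (by simp)] at key
    simp only [intervalIntegral.integral_const, Real.sin_pi_div_two, Real.sin_zero] at key
    have e1 : ε ^ 2 + (1 - ε ^ 2) * 1 ^ 2 = 1 := by ring
    have e2 : ε ^ 2 + (1 - ε ^ 2) * 0 ^ 2 = ε ^ 2 := by ring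
    rw [e1, e2, Real.sqrt_one, Real.sqrt_sq h0.le, zero_add, add_zero, Real.log_one, smul_eq_mul]
      at key
    rw [one_div ε, Real.log_inv]
    linarith
  · refine ContinuousOn.sub (ContinuousOn.log (by fun_prop) fun x hx => ?_)
      (ContinuousOn.log (by fun_prop) fun x hx => ?_)
    all_goals
      have hs : 0 ≤ Real.sin x :=
        Real.sin_nonneg_of_nonneg_of_le_pi hx.1 (by linarith [hx.2, Real.pi_pos])
      have := Real.sqrt_pos.2 (hpos x)
      positivity
  · intro x hx
    have hc : 0 < Real.cos x := Real.cos_pos_of_mem_Ioo ⟨by linarith [hx.1, Real.pi_pos], hx.2⟩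
    have hW1 : √(ε ^ 2 + (1 - ε ^ 2) * Real.sin x ^ 2) ≤ 1 := by
      refine Real.sqrt_le_one.2 ?_
      nlinarith [Real.sin_sq_le_one x]
    have hW0 := Real.sqrt_pos.2 (hpos x)
    have h2 : 0 ≤ 1 / √(ε ^ 2 + (1 - ε ^ 2) * Real.sin x ^ 2) - 1 := by
      rw [sub_nonneg, le_div_iff₀ hW0]
      linarith
    exact le_mul_of_one_le_left h2 (by rw [le_div_iff₀ hc]; linarith [Real.cos_le_one x])

/-- The substitution `θ = 2x` turns `K(r)` into a complete elliptic integral with `ε = (1 - r)/(1 +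
r)`. -/
lemma kernelConst_le_log {r : ℝ} (h0 : 0 < r) (h1 : r < 1) :
    kernelConst r ≤ 2 * r / (Real.pi * (1 + r)) *
      (Real.pi / 2 + Real.log ((1 + r) / (1 - r))) := by
  have hr : 0 < 1 - r := by linarith
  set ε := (1 - r) / (1 + r) with hε
  have hε0 : 0 < ε := by positivity
  have hε1 : ε < 1 := by rw [hε, div_lt_one (by positivity)]; linarith
  have hk : 0 < 1 - ε ^ 2 := by nlinarith
  have hpos : ∀ x, 0 < ε ^ 2 + (1 - ε ^ 2) * Real.sin x ^ 2 := fun x => by positivity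
  let g : ℝ → ℝ := fun x => 1 / √(ε ^ 2 + (1 - ε ^ 2) * Real.sin x ^ 2)
  have hg : Continuous g :=
    continuous_const.div (by fun_prop) fun x => (Real.sqrt_pos.2 (hpos x)).ne'
  have hfg : ∀ x, r / ‖(1 : ℂ) - circleMap 0 r (2 * x)‖ = r / (1 + r) * g x := by
    intro x
    have : ‖(1 : ℂ) - circleMap 0 r (2 * x)‖
        = (1 + r) * √(ε ^ 2 + (1 - ε ^ 2) * Real.sin x ^ 2) := by
      rw [← Real.sqrt_sq (norm_nonneg _), sq_norm_one_sub_circleMap,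
        ← Real.sqrt_sq (show 0 ≤ 1 + r by positivity), ← Real.sqrt_mul (by positivity),
        Real.cos_two_mul, hε]
      congr 1
      have := Real.sin_sq_add_cos_sq x
      have h1r : 1 + r ≠ 0 := by positivity
      field_simp
      linear_combination -4 * r * this
    rw [this]
    simp only [g]
    field_simp
  have hsub : ∫ θ in (0 : ℝ)..(2 * Real.pi), r / ‖(1 : ℂ) - circleMap 0 r θ‖
      = 2 * ∫ x in (0 : ℝ)..Real.pi, r / (1 + r) * g x := by
    have := intervalIntegral.mul_integral_comp_mul_left (a := 0) (b := Real.pi)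
      (f := fun θ : ℝ => r / ‖(1 : ℂ) - circleMap 0 r θ‖) 2
    rw [mul_zero] at this
    rw [← this]
    simp_rw [hfg]
  have hsym : ∫ x in (Real.pi / 2)..Real.pi, g x = ∫ x in (0 : ℝ)..(Real.pi / 2), g x := by
    have := intervalIntegral.integral_comp_sub_left (a := 0) (b := Real.pi / 2) g Real.pi
    rw [sub_zero, show Real.pi - Real.pi / 2 = Real.pi / 2 by ring] at this
    rw [← this]
    simp [g, Real.sin_pi_sub]
  have hsplit := intervalIntegral.integral_add_adjacent_intervals (μ := volume)
    (hg.intervalIntegrable 0 (Real.pi / 2)) (hg.intervalIntegrable (Real.pi / 2) Real.pi)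
  have hle := integral_elliptic_le hε0 hε1
  unfold kernelConst
  rw [hsub, intervalIntegral.integral_const_mul, ← hsplit, hsym]
  have hlog : Real.log (1 / ε) = Real.log ((1 + r) / (1 - r)) := by rw [hε, one_div_div]
  rw [hlog] at hle
  calc _ = 2 * r / (Real.pi * (1 + r)) * ∫ x in (0 : ℝ)..(Real.pi / 2), g x := by
        field_simp
        ring
    _ ≤ _ := by gcongr

/-! ### Projective maps of positive matrices -/

lemma F_apply_one_one (A : Matrix (Fin 2) (Fin 2) ℝ) :
    F A 1 1 = (A 0 0 + A 0 1 + A 1 0 + A 1 1) / 2 := by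
  simp [F]; ring

lemma F_apply_one_zero (A : Matrix (Fin 2) (Fin 2) ℝ) :
    F A 1 0 = (A 0 0 - A 0 1 + A 1 0 - A 1 1) / 2 := by
  simp [F]; ring

lemma F_apply_zero_one (A : Matrix (Fin 2) (Fin 2) ℝ) :
    F A 0 1 = (A 0 0 + A 0 1 - A 1 0 - A 1 1) / 2 := by
  simp [F]; ring

lemma F_apply_zero_zero (A : Matrix (Fin 2) (Fin 2) ℝ) :
    F A 0 0 = (A 0 0 - A 0 1 - A 1 0 + A 1 1) / 2 := by
  simp [F]; ring

lemma det_F (A : Matrix (Fin 2) (Fin 2) ℝ) : (F A).det = A.det := by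
  rw [Matrix.det_fin_two, Matrix.det_fin_two, F_apply_one_one, F_apply_one_zero,
    F_apply_zero_one, F_apply_zero_zero]
  ring

lemma abs_F_one_zero_lt {A : Matrix (Fin 2) (Fin 2) ℝ} (hA : ∀ a b, 0 < A a b) :
    |F A 1 0| < F A 1 1 := by
  rw [F_apply_one_one, F_apply_one_zero, abs_lt]
  constructor <;> linarith [hA 0 0, hA 0 1, hA 1 0, hA 1 1]

lemma F_one_one_pos {A : Matrix (Fin 2) (Fin 2) ℝ} (hA : ∀ a b, 0 < A a b) : 0 < F A 1 1 :=
  (abs_nonneg _).trans_lt (abs_F_one_zero_lt hA)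

lemma denom_pos {γ d x : ℝ} (h : |γ| < d) (hx : |x| ≤ 1) : 0 < γ * x + d := by
  have h1 : |γ * x| ≤ |γ| := by
    rw [abs_mul]
    exact mul_le_of_le_one_right (abs_nonneg _) hx
  linarith [neg_abs_le (γ * x)]

lemma proj_zero (A : Matrix (Fin 2) (Fin 2) ℝ) : proj A 0 = F A 0 1 / F A 1 1 := by
  simp [proj, mobius]

lemma projT_zero (A : Matrix (Fin 2) (Fin 2) ℝ) : projT A 0 = F A 1 0 / F A 1 1 := by
  simp [projT, mobius]

lemma proj_apply (A : Matrix (Fin 2) (Fin 2) ℝ) (x : ℝ) :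
    proj A x = (F A 0 0 * x + F A 0 1) / (F A 1 0 * x + F A 1 1) := rfl

lemma abs_projT_zero_lt_one {A : Matrix (Fin 2) (Fin 2) ℝ} (hA : ∀ a b, 0 < A a b) :
    |projT A 0| < 1 := by
  rw [projT_zero, abs_div, abs_of_pos (F_one_one_pos hA), div_lt_one (F_one_one_pos hA)]
  exact abs_F_one_zero_lt hA

lemma hasDerivAt_proj {A : Matrix (Fin 2) (Fin 2) ℝ} {x : ℝ} (hx : F A 1 0 * x + F A 1 1 ≠ 0) :
    HasDerivAt (proj A) ((F A).det / (F A 1 0 * x + F A 1 1) ^ 2) x := by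
  have h1 : HasDerivAt (fun x => F A 0 0 * x + F A 0 1) (F A 0 0) x := by
    simpa using ((hasDerivAt_id x).const_mul (F A 0 0)).add_const (F A 0 1)
  have h2 : HasDerivAt (fun x => F A 1 0 * x + F A 1 1) (F A 1 0) x := by
    simpa using ((hasDerivAt_id x).const_mul (F A 1 0)).add_const (F A 1 1)
  refine (h1.div h2 hx).congr_deriv ?_
  rw [Matrix.det_fin_two]
  ring

lemma deriv_proj_zero {A : Matrix (Fin 2) (Fin 2) ℝ} (hA : F A 1 1 ≠ 0) :
    deriv (proj A) 0 = (F A).det / F A 1 1 ^ 2 := by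
  simpa using (hasDerivAt_proj (A := A) (x := 0) (by simpa using hA)).deriv

lemma proj_mem_bounds {A : Matrix (Fin 2) (Fin 2) ℝ} (hA : ∀ a b, 0 < A a b) {r : ℝ}
    (hr : Set.MapsTo (proj A) (Set.Icc (-1) 1) (Set.Icc (-r) r)) :
    |F A 0 0 + F A 0 1| ≤ r * (F A 1 1 + F A 1 0) ∧
      |F A 0 1 - F A 0 0| ≤ r * (F A 1 1 - F A 1 0) := by
  have hlt := abs_lt.1 (abs_F_one_zero_lt hA)
  have h1 : |proj A 1| ≤ r := abs_le.2 (hr (by simp))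
  have h2 : |proj A (-1)| ≤ r := abs_le.2 (hr (by simp))
  rw [proj_apply, abs_div] at h1 h2
  rw [div_le_iff₀ (abs_pos.2 (by linarith))] at h1 h2
  rw [abs_of_pos (by linarith : 0 < F A 1 0 * 1 + F A 1 1), mul_one, mul_one] at h1
  rw [abs_of_pos (by linarith : 0 < F A 1 0 * -1 + F A 1 1)] at h2
  constructor
  · linarith
  · calc _ = |F A 0 0 * -1 + F A 0 1| := by congr 1; ring
      _ ≤ _ := h2
      _ = _ := by ring

/-- A real Möbius map which sends `[-1, 1]` into `[-r, r]` sends the closed unit disc to the disc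
of radius `r`. -/
lemma norm_le_of_abs_le {α β γ d r : ℝ} (h1 : |α + β| ≤ r * (d + γ)) (h2 : |β - α| ≤ r * (d - γ))
    (hγ : |γ| < d) (hr : 0 ≤ r) {z : ℂ} (hz : ‖z‖ ≤ 1) :
    ‖(α : ℂ) * z + β‖ ≤ r * ‖(γ : ℂ) * z + d‖ := by
  -- Both sides before squaring are affine in `t`, so the bounds at `t = ±1` extend to the whole
  -- interval.
  have hq : ∀ t : ℝ, |t| ≤ 1 → (α * t + β) ^ 2 ≤ r ^ 2 * (γ * t + d) ^ 2 := by
    intro t ht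
    rw [← mul_pow, sq_le_sq, abs_mul, abs_of_nonneg hr, abs_of_pos (denom_pos hγ ht)]
    rw [abs_le] at *
    constructor <;> nlinarith
  have hre : |z.re| ≤ ‖z‖ := Complex.abs_re_le_norm z
  have hzz : ‖z‖ ^ 2 = z.re * z.re + z.im * z.im := by
    rw [← Complex.normSq_eq_norm_sq, Complex.normSq_apply]
  have hz0 := norm_nonneg z
  have ha := hq ‖z‖ (by rwa [abs_of_nonneg hz0])
  have hb := hq (-‖z‖) (by rwa [abs_neg, abs_of_nonneg hz0])
  refine le_of_sq_le_sq ?_ (by positivity)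
  rw [mul_pow, ← Complex.normSq_eq_norm_sq, ← Complex.normSq_eq_norm_sq, Complex.normSq_apply,
    Complex.normSq_apply]
  simp only [Complex.add_re, Complex.mul_re, Complex.ofReal_re, Complex.ofReal_im, zero_mul,
    sub_zero, Complex.add_im, Complex.mul_im, add_zero]
  rw [abs_le] at hre
  -- For fixed `‖z‖` the difference of squares is affine in `z.re`, so its maximum is at the real
  -- point `‖z‖` or `-‖z‖`. The sign of the slope decides which.
  by_cases hB : 0 ≤ r ^ 2 * γ * d - α * β
  · have h := mul_nonneg hB (by linarith : 0 ≤ z.re + ‖z‖)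
    linear_combination hb + 2 * h - (α ^ 2 - r ^ 2 * γ ^ 2) * hzz
  · have h := mul_nonneg_of_nonpos_of_nonpos (not_le.1 hB).le (by linarith : z.re - ‖z‖ ≤ 0)
    linear_combination ha + 2 * h - (α ^ 2 - r ^ 2 * γ ^ 2) * hzz

/-- The Schwarz–Pick inequality for real Möbius maps. -/
lemma schwarzPick {α β γ d x : ℝ} (h1 : |α + β| ≤ d + γ) (h2 : |β - α| ≤ d - γ) (hx : |x| ≤ 1) :
    |α * d - β * γ| * (1 - x ^ 2) ≤ (γ * x + d) ^ 2 - (α * x + β) ^ 2 := by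
  rw [abs_le] at *
  obtain ⟨a1, a2⟩ := h1
  obtain ⟨b1, b2⟩ := h2
  obtain ⟨x1, x2⟩ := hx
  have hst : 0 ≤ 1 - x ^ 2 := by nlinarith
  -- Let `P, Q = d + γ ± (α + β)` and `R, S = d - γ ± (β - α)`, all nonnegative. Four times the
  -- right side is `PQ(1+x)² + RS(1-x)² + (PS+QR)(1-x²)`, while `4(αd - βγ) = PS - QR`.
  have e2 := mul_nonneg (sub_nonneg.2 a1) (sub_nonneg.2 b2)
  have e3 := mul_nonneg (sub_nonneg.2 a2) (sub_nonneg.2 b1)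
  have s1 := mul_nonneg (mul_nonneg (sub_nonneg.2 a1) (sub_nonneg.2 a2)) (sq_nonneg (1 + x))
  have s2 := mul_nonneg (mul_nonneg (sub_nonneg.2 b1) (sub_nonneg.2 b2)) (sq_nonneg (1 - x))
  rcases abs_cases (α * d - β * γ) with ⟨h, _⟩ | ⟨h, _⟩ <;> rw [h]
  · nlinarith [mul_nonneg e2 hst, mul_nonneg e3 hst]
  · nlinarith [mul_nonneg e2 hst, mul_nonneg e3 hst]

lemma hasDerivAt_artanh {x : ℝ} (hx : x ∈ Set.Ioo (-1 : ℝ) 1) :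
    HasDerivAt Real.artanh (1 / (1 - x ^ 2)) x := by
  have h1 : 0 < 1 + x := by linarith [hx.1]
  have h2 : 0 < 1 - x := by linarith [hx.2]
  have h : HasDerivAt (fun x => 1 / 2 * (Real.log (1 + x) - Real.log (1 - x)))
      (1 / 2 * (1 / (1 + x) - (-1) / (1 - x))) x :=
    ((((hasDerivAt_id x).const_add 1).log h1.ne').sub
      (((hasDerivAt_id x).const_sub 1).log h2.ne')).const_mul _
  refine (h.congr_deriv ?_).congr_of_eventuallyEq ?_
  · rw [show 1 - x ^ 2 = (1 + x) * (1 - x) by ring]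
    field_simp
    ring
  · filter_upwards [isOpen_Ioo.mem_nhds hx] with y hy
    have h1 : 0 < 1 + y := by linarith [hy.1]
    have h2 : 0 < 1 - y := by linarith [hy.2]
    rw [Real.artanh_eq_half_log ⟨hy.1.le, hy.2.le⟩, Real.log_div (ne_of_gt h1) (ne_of_gt h2)]

/-- Mean value inequality with respect to a reference function. -/
lemma abs_sub_le_abs_sub_of_deriv_le {f g f' g' : ℝ → ℝ} {s : Set ℝ} (hs : Convex ℝ s)
    (hf : ∀ x ∈ s, HasDerivAt f (f' x) x) (hg : ∀ x ∈ s, HasDerivAt g (g' x) x)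
    (hle : ∀ x ∈ s, |f' x| ≤ g' x) {x y : ℝ} (hx : x ∈ s) (hy : y ∈ s) :
    |f x - f y| ≤ |g x - g y| := by
  -- Both `g + f` and `g - f` are increasing, which is the claim without absolute values.
  have hm : ∀ σ : ℝ, |σ| = 1 → MonotoneOn (fun x => g x + σ * f x) s := by
    intro σ hσ
    have hd : ∀ x ∈ s, HasDerivAt (fun x => g x + σ * f x) (g' x + σ * f' x) x :=
      fun x hx => (hg x hx).add ((hf x hx).const_mul σ)
    refine monotoneOn_of_deriv_nonneg hs
      (fun x hx => (hd x hx).continuousAt.continuousWithinAt)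
      (fun x hx => (hd x (interior_subset hx)).differentiableAt.differentiableWithinAt)
      fun x hx => ?_
    have hx := interior_subset hx
    rw [(hd x hx).deriv]
    have : |σ * f' x| ≤ g' x := by rw [abs_mul, hσ, one_mul]; exact hle x hx
    linarith [neg_abs_le (σ * f' x)]
  have key : ∀ x ∈ s, ∀ y ∈ s, x ≤ y → |f x - f y| ≤ |g x - g y| := by
    intro x hx y hy hxy
    have h1 := hm 1 (by simp) hx hy hxy
    have h2 := hm (-1) (by simp) hx hy hxy
    simp only at h1 h2
    refine le_trans ?_ (neg_le_abs _)
    rw [abs_le]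
    constructor <;> linarith
  rcases le_total x y with h | h
  · exact key x hx y hy h
  · rw [abs_sub_comm, abs_sub_comm (g x)]
    exact key y hy x hx h

lemma abs_lt_one_of_mem_Icc {r x : ℝ} (hr1 : r < 1) (hx : x ∈ Set.Icc (-r) r) :
    x ∈ Set.Ioo (-1 : ℝ) 1 := ⟨by linarith [hx.1], by linarith [hx.2]⟩

/-- Projective maps contract the hyperbolic distance by the factor `r`. -/
lemma abs_artanh_proj_sub_le {A : Matrix (Fin 2) (Fin 2) ℝ} (hA : ∀ a b, 0 < A a b) {r : ℝ}
    (hr0 : 0 < r) (hr1 : r < 1)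
    (hr : Set.MapsTo (proj A) (Set.Icc (-1) 1) (Set.Icc (-r) r)) {x y : ℝ}
    (hx : x ∈ Set.Ioo (-1 : ℝ) 1) (hy : y ∈ Set.Ioo (-1 : ℝ) 1) :
    |Real.artanh (proj A x) - Real.artanh (proj A y)|
      ≤ r * |Real.artanh x - Real.artanh y| := by
  have hγ := abs_F_one_zero_lt hA
  have hden : ∀ x ∈ Set.Ioo (-1 : ℝ) 1, 0 < F A 1 0 * x + F A 1 1 := fun x hx =>
    denom_pos hγ (abs_le.2 ⟨hx.1.le, hx.2.le⟩)
  have hmem : ∀ x ∈ Set.Ioo (-1 : ℝ) 1, proj A x ∈ Set.Ioo (-1 : ℝ) 1 := fun x hx =>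
    abs_lt_one_of_mem_Icc hr1 (hr ⟨hx.1.le, hx.2.le⟩)
  have h := abs_sub_le_abs_sub_of_deriv_le (f := fun x => Real.artanh (proj A x))
    (g := fun x => r * Real.artanh x)
    (f' := fun x => 1 / (1 - proj A x ^ 2) * ((F A).det / (F A 1 0 * x + F A 1 1) ^ 2))
    (g' := fun x => r * (1 / (1 - x ^ 2))) (convex_Ioo (-1) 1)
    (fun x hx => (hasDerivAt_artanh (hmem x hx)).comp x (hasDerivAt_proj (hden x hx).ne'))
    (fun x hx => (hasDerivAt_artanh hx).const_mul r) ?_ hx hy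
  · rwa [← mul_sub, abs_mul, abs_of_pos hr0] at h
  intro x hx
  have hd := hden x hx
  obtain ⟨b1, b2⟩ := proj_mem_bounds hA hr
  -- Schwarz–Pick is applied to `f / r`, which still maps `[-1, 1]` to itself. This gains the factor
  -- `r`, and `h4` below then replaces `(f / r)²` by the smaller `f²`.
  have hsp := schwarzPick (α := F A 0 0 / r) (β := F A 0 1 / r) (γ := F A 1 0) (d := F A 1 1)
    (x := x) (by rw [← add_div, abs_div, abs_of_pos hr0, div_le_iff₀ hr0]; linarith)
    (by rw [← sub_div, abs_div, abs_of_pos hr0, div_le_iff₀ hr0]; linarith)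
    (abs_le.2 ⟨hx.1.le, hx.2.le⟩)
  have e1 : F A 0 0 / r * F A 1 1 - F A 0 1 / r * F A 1 0 = (F A).det / r := by
    rw [Matrix.det_fin_two]; ring
  have e2 : F A 0 0 / r * x + F A 0 1 / r = (F A 0 0 * x + F A 0 1) / r := by ring
  rw [e1, e2, abs_div, abs_of_pos hr0, div_pow] at hsp
  have hx2 : 0 < 1 - x ^ 2 := by nlinarith [hx.1, hx.2]
  have hp := hmem x hx
  have hp2 : 0 < 1 - proj A x ^ 2 := by nlinarith [hp.1, hp.2]
  have hnum : (F A 0 0 * x + F A 0 1) = proj A x * (F A 1 0 * x + F A 1 1) := by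
    rw [proj_apply, div_mul_cancel₀ _ hd.ne']
  rw [hnum] at hsp
  set D := F A 1 0 * x + F A 1 1
  set q := proj A x
  have h3 : |(F A).det| * (1 - x ^ 2) ≤ r * (D ^ 2 * (1 - q ^ 2)) := by
    have h4 : (q * D) ^ 2 ≤ (q * D) ^ 2 / r ^ 2 :=
      le_div_self (sq_nonneg _) (by positivity) (by nlinarith)
    have h5 : |(F A).det| * (1 - x ^ 2) = r * (|(F A).det| / r * (1 - x ^ 2)) := by
      field_simp
    rw [h5]
    exact mul_le_mul_of_nonneg_left (by linarith) hr0.le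
  rw [abs_mul, abs_div, abs_div, abs_one, abs_of_pos hp2, abs_of_pos (by positivity : 0 < D ^ 2),
    mul_one_div, div_mul_div_comm, one_mul, div_le_div_iff₀ (by positivity) hx2]
  linarith

/-- The logarithm of the affine cocycle is Lipschitz for the hyperbolic distance. -/
lemma abs_log_sub_log_le {c d : ℝ} (hc : |c| < 1) (hd : 0 < d) {x y : ℝ}
    (hx : x ∈ Set.Ioo (-1 : ℝ) 1) (hy : y ∈ Set.Ioo (-1 : ℝ) 1) :
    |Real.log (d * (1 + c * x)) - Real.log (d * (1 + c * y))|
      ≤ 2 * (|c| / (1 + √(1 - |c| ^ 2))) * |Real.artanh x - Real.artanh y| := by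
  have hden : ∀ x ∈ Set.Ioo (-1 : ℝ) 1, 0 < 1 + c * x := fun x hx => by
    have := denom_pos hc (abs_le.2 ⟨hx.1.le, hx.2.le⟩)
    linarith
  set e := √(1 - |c| ^ 2) with he
  have hc2 : 0 ≤ 1 - |c| ^ 2 := by nlinarith [abs_nonneg c]
  have he0 : 0 ≤ e := Real.sqrt_nonneg _
  have he2 : e ^ 2 = 1 - c ^ 2 := by rw [he, Real.sq_sqrt hc2, sq_abs]
  have hκ : 0 ≤ 2 * (|c| / (1 + e)) := by positivity
  have h := abs_sub_le_abs_sub_of_deriv_le (f := fun x => Real.log (d * (1 + c * x)))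
    (g := fun x => 2 * (|c| / (1 + e)) * Real.artanh x)
    (f' := fun x => d * c / (d * (1 + c * x)))
    (g' := fun x => 2 * (|c| / (1 + e)) * (1 / (1 - x ^ 2))) (convex_Ioo (-1) 1)
    (fun x hx => ?_) (fun x hx => (hasDerivAt_artanh hx).const_mul _) ?_ hx hy
  · rwa [← mul_sub, abs_mul, abs_of_nonneg hκ] at h
  · refine HasDerivAt.log ?_ (mul_pos hd (hden x hx)).ne'
    simpa using (((hasDerivAt_id x).const_mul c).const_add 1).const_mul d
  · intro x hx
    have hx2 : 0 < 1 - x ^ 2 := by nlinarith [hx.1, hx.2]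
    have hp := hden x hx
    rw [mul_div_mul_left _ _ hd.ne', abs_div, abs_of_pos hp,
      show 2 * (|c| / (1 + e)) * (1 / (1 - x ^ 2)) = |c| * (2 / ((1 + e) * (1 - x ^ 2))) by
        field_simp, div_eq_mul_one_div]
    refine mul_le_mul_of_nonneg_left ?_ (abs_nonneg c)
    rw [div_le_div_iff₀ hp (by positivity)]
    -- Since `1 - e² = c²`, this product equals `((1 + e) x + c)²`. So `2 / (1 + e)` is the exact
    -- maximum of `(1 - x²) / (1 + c x)`, attained at `x = -c / (1 + e)`.
    have : 0 ≤ (1 + e) * (2 * (1 + c * x) - 1 * ((1 + e) * (1 - x ^ 2))) := by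
      nlinarith [sq_nonneg ((1 + e) * x + c)]
    have := nonneg_of_mul_nonneg_right this (by positivity)
    linarith

lemma artanh_neg_apply {x : ℝ} (hx : x ∈ Set.Ioo (-1 : ℝ) 1) :
    Real.artanh (-x) = -Real.artanh x := by
  rw [Real.artanh_eq_half_log ⟨hx.1.le, hx.2.le⟩,
    Real.artanh_eq_half_log ⟨by linarith [hx.2], by linarith [hx.1]⟩, sub_neg_eq_add,
    ← sub_eq_add_neg, ← inv_div (1 + x), Real.log_inv]
  ring

lemma dHyp_zero {a : ℝ} (ha : a ∈ Set.Ioo (-1 : ℝ) 1) : dHyp a 0 = 2 * |Real.artanh a| := by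
  simp only [dHyp, sub_zero, mul_zero, div_one]
  rcases le_total 0 a with h | h
  · rw [abs_of_nonneg h, abs_of_nonneg (Real.artanh_nonneg h)]
  · rw [abs_of_nonpos h, abs_of_nonpos (Real.artanh_nonpos h), artanh_neg_apply ha]

/-! ### Taylor tails on discs -/

lemma norm_circleMap_sub_circleMap (r θ α : ℝ) :
    ‖circleMap 0 1 θ - circleMap 0 r α‖ = ‖(1 : ℂ) - circleMap 0 r (α - θ)‖ := by
  have h : circleMap 0 1 θ - circleMap 0 r α
      = circleMap 0 1 θ * ((1 : ℂ) - circleMap 0 r (α - θ)) := by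
    simp only [circleMap, zero_add, Complex.ofReal_one, one_mul, mul_sub, mul_one,
      Complex.ofReal_sub, sub_mul, Complex.exp_sub]
    field_simp [Complex.exp_ne_zero]
  rw [h, norm_mul, norm_circleMap_zero, abs_one, one_mul]

/-- By rotation invariance only `‖z‖` matters, so the average is the one at the point `r`. -/
lemma integral_div_norm_circleMap_sub {r : ℝ} {z : ℂ} (hz : ‖z‖ = r) :
    ∫ θ in (0 : ℝ)..(2 * Real.pi), r / ‖circleMap 0 1 θ - z‖ = 2 * Real.pi * kernelConst r := by
  have hzα : z = circleMap 0 r z.arg := by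
    rw [circleMap, zero_add, ← hz, Complex.norm_mul_exp_arg_mul_I]
  have hper : Function.Periodic (fun θ : ℝ => r / ‖(1 : ℂ) - circleMap 0 r θ‖)
      (2 * Real.pi) := fun θ => by simp only [periodic_circleMap 0 r θ]
  rw [hzα]
  simp_rw [norm_circleMap_sub_circleMap]
  rw [intervalIntegral.integral_comp_sub_left
    (fun θ : ℝ => r / ‖(1 : ℂ) - circleMap 0 r θ‖), sub_zero]
  have h := hper.intervalIntegral_add_eq (z.arg - 2 * Real.pi) 0
  rw [sub_add_cancel, zero_add] at h
  rw [h, kernelConst]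
  field_simp

/-- Cauchy's formula for `g z` minus Cauchy's formulas for the coefficients: the geometric sum
`∑_{n<m} (z/ζ)^n / ζ` leaves the kernel `(z/ζ)^m / (ζ - z)`. Uniqueness of power series identifies
`coeff` with the Cauchy coefficients. -/
lemma taylor_tail_eq_circleIntegral {g : ℂ → ℂ} {coeff : ℕ → ℂ}
    (hd : DiffContOnCl ℂ g (Metric.ball 0 1))
    (hs : ∀ z : ℂ, ‖z‖ ≤ 1 → HasSum (fun n => coeff n * z ^ n) (g z))
    {z : ℂ} (hz : ‖z‖ < 1) (m : ℕ) :
    g z - ∑ n ∈ Finset.range m, coeff n * z ^ n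
      = (2 * Real.pi * Complex.I : ℂ)⁻¹ •
        ∮ ζ in C(0, 1), (z / ζ) ^ m • (ζ - z)⁻¹ • g ζ := by
  have hcont : ContinuousOn g (Metric.sphere 0 1) :=
    hd.continuousOn_ball.mono Metric.sphere_subset_closedBall
  have hmem : z ∈ Metric.ball (0 : ℂ) 1 := by simpa using hz
  have hcauchy := hd.hasFPowerSeriesOnBall (R := 1) one_pos
  have hsummable : Summable fun n => ‖coeff n‖ := by
    simpa using (hs 1 (by simp)).summable.norm
  have hseries : HasFPowerSeriesOnBall g (FormalMultilinearSeries.ofScalars ℂ coeff) 0 1 := by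
    refine ⟨?_, one_pos, fun {y} hy => ?_⟩
    · have := (FormalMultilinearSeries.ofScalars ℂ coeff).le_radius_of_summable_norm (r := 1)
        (by simpa [FormalMultilinearSeries.ofScalars_norm] using hsummable)
      simpa using this
    · have hy' : ‖y‖ ≤ 1 := by
        have : ‖y‖ < 1 := by simpa [← ofReal_norm, ENNReal.ofReal_lt_one] using hy
        exact this.le
      simpa [mul_comm] using hs y hy'
  have heq := hseries.hasFPowerSeriesAt.eq_formalMultilinearSeries hcauchy.hasFPowerSeriesAt
  have hcoeff : ∀ n, coeff n * z ^ n = (2 * Real.pi * Complex.I : ℂ)⁻¹ •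
      ∮ ζ in C(0, 1), (z / ζ) ^ n • ζ⁻¹ • g ζ := by
    intro n
    have h1 : (FormalMultilinearSeries.ofScalars ℂ coeff) n (fun _ => z) = coeff n * z ^ n := by
      simp [mul_comm]
    rw [← h1, heq]
    have := cauchyPowerSeries_apply g 0 1 n z
    simpa using this
  have hne : ∀ ζ ∈ Metric.sphere (0 : ℂ) 1, ζ ≠ 0 := fun ζ hζ h => by
    simp [h] at hζ
  have hne' : ∀ ζ ∈ Metric.sphere (0 : ℂ) 1, ζ - z ≠ 0 := fun ζ hζ h => by
    rw [sub_eq_zero] at h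
    simp [h] at hζ
    linarith
  have hint : ∀ n, CircleIntegrable (fun ζ => (z / ζ) ^ n • ζ⁻¹ • g ζ) 0 1 := fun n =>
    ContinuousOn.circleIntegrable zero_le_one
      (((continuousOn_const.div continuousOn_id hne).pow n).smul
        ((continuousOn_id.inv₀ hne).smul hcont))
  have hint2 : CircleIntegrable (fun ζ => (ζ - z)⁻¹ • g ζ) 0 1 :=
    ContinuousOn.circleIntegrable zero_le_one
      (((continuousOn_id.sub continuousOn_const).inv₀ hne').smul hcont)
  have hint3 : CircleIntegrable (fun ζ => ∑ n ∈ Finset.range m, (z / ζ) ^ n • ζ⁻¹ • g ζ) 0 1 :=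
    ContinuousOn.circleIntegrable zero_le_one
      (continuousOn_finsetSum _ fun n _ => ((continuousOn_const.div continuousOn_id hne).pow n).smul
        ((continuousOn_id.inv₀ hne).smul hcont))
  have hg : g z = (2 * Real.pi * Complex.I : ℂ)⁻¹ • ∮ ζ in C(0, 1), (ζ - z)⁻¹ • g ζ :=
    (hd.two_pi_i_inv_smul_circleIntegral_sub_inv_smul hmem).symm
  rw [Finset.sum_congr rfl fun n _ => hcoeff n, ← Finset.smul_sum, hg, ← smul_sub,
    ← circleIntegral.integral_fun_sum fun n _ => hint n,
    ← circleIntegral.integral_sub hint2 hint3]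
  congr 1
  refine circleIntegral.integral_congr zero_le_one fun ζ hζ => ?_
  have h0 := hne ζ hζ
  have h1 := hne' ζ hζ
  simp only [smul_eq_mul]
  rw [← Finset.sum_mul]
  have hq : z / ζ ≠ 1 := fun h => h1 (by rw [(div_eq_one_iff_eq h0).1 h, sub_self])
  rw [geom_sum_eq hq]
  have h2 : z - ζ ≠ 0 := fun h => h1 (by rw [← neg_sub, h, neg_zero])
  have h3 : z / ζ - 1 = (z - ζ) / ζ := by field_simp
  rw [h3, ← neg_sub z ζ]
  generalize (z / ζ) ^ m = q
  field_simp
  ring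

lemma norm_taylor_tail_le {g : ℂ → ℂ} {coeff : ℕ → ℂ}
    (hd : DiffContOnCl ℂ g (Metric.ball 0 1))
    (hs : ∀ z : ℂ, ‖z‖ ≤ 1 → HasSum (fun n => coeff n * z ^ n) (g z))
    {M : ℝ} (hM : ∀ z : ℂ, ‖z‖ ≤ 1 → ‖g z‖ ≤ M) {r : ℝ} (hr0 : 0 < r) (hr1 : r < 1)
    {m : ℕ} (hm : 1 ≤ m) {z : ℂ} (hz : ‖z‖ ≤ r) :
    ‖g z - ∑ n ∈ Finset.range m, coeff n * z ^ n‖ ≤ M * (r ^ (m - 1) * kernelConst r) := by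
  have hM0 : 0 ≤ M := (norm_nonneg _).trans (hM 0 (by simp))
  -- On the circle `‖z‖ = r` the integral of the kernel is exactly `K(r)`. The maximum principle
  -- handles the interior.
  have hbd : ∀ z : ℂ, ‖z‖ = r →
      ‖g z - ∑ n ∈ Finset.range m, coeff n * z ^ n‖ ≤ M * (r ^ (m - 1) * kernelConst r) := by
    intro z hz
    have hne : ∀ θ : ℝ, 0 < ‖circleMap 0 1 θ - z‖ := fun θ => by
      rw [norm_pos_iff, sub_ne_zero]
      intro h
      have := norm_circleMap_zero 1 θ
      rw [h, hz, abs_one] at this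
      linarith
    rw [taylor_tail_eq_circleIntegral hd hs (hz.trans_lt hr1) m, norm_smul, circleIntegral]
    have h1 : ‖∫ θ in (0 : ℝ)..(2 * Real.pi), deriv (circleMap 0 1) θ •
        ((z / circleMap 0 1 θ) ^ m • (circleMap 0 1 θ - z)⁻¹ • g (circleMap 0 1 θ))‖
        ≤ ∫ θ in (0 : ℝ)..(2 * Real.pi), M * r ^ (m - 1) * (r / ‖circleMap 0 1 θ - z‖) := by
      refine intervalIntegral.norm_integral_le_of_norm_le (by positivity) ?_ ?_
      · refine Eventually.of_forall fun θ _ => ?_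
        have hg := hM (circleMap 0 1 θ) (by simp)
        have hrm : r ^ m = r ^ (m - 1) * r := by rw [← pow_succ, Nat.sub_add_cancel hm]
        simp only [norm_smul, norm_pow, norm_div, norm_inv, hz, norm_circleMap_zero, abs_one,
          div_one, deriv_circleMap, norm_mul, Complex.norm_I, mul_one, one_mul]
        rw [hrm]
        calc r ^ (m - 1) * r * (‖circleMap 0 1 θ - z‖⁻¹ * ‖g (circleMap 0 1 θ)‖)
            = ‖g (circleMap 0 1 θ)‖ * (r ^ (m - 1) * (r / ‖circleMap 0 1 θ - z‖)) := by
              rw [div_eq_mul_inv]; ring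
          _ ≤ M * (r ^ (m - 1) * (r / ‖circleMap 0 1 θ - z‖)) := by gcongr
          _ = _ := by ring
      · refine Continuous.intervalIntegrable (continuous_const.mul (continuous_const.div ?_
          fun θ => (hne θ).ne')) _ _
        exact ((continuous_circleMap 0 1).sub continuous_const).norm
    rw [intervalIntegral.integral_const_mul, integral_div_norm_circleMap_sub hz] at h1
    have h2 : ‖(2 * Real.pi * Complex.I : ℂ)⁻¹‖ = (2 * Real.pi)⁻¹ := by
      simp [abs_of_pos Real.pi_pos]
    rw [h2]
    calc _ ≤ (2 * Real.pi)⁻¹ * (M * r ^ (m - 1) * (2 * Real.pi * kernelConst r)) := by gcongr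
      _ = _ := by field_simp
  have hclosure : closure (Metric.ball (0 : ℂ) r) = Metric.closedBall 0 r :=
    closure_ball _ hr0.ne'
  refine Complex.norm_le_of_forall_mem_frontier_norm_le (U := Metric.ball 0 r)
    Metric.isBounded_ball (f := fun z => g z - ∑ n ∈ Finset.range m, coeff n * z ^ n) ?_ ?_ ?_
  · refine (hd.mono (Metric.ball_subset_ball hr1.le)).sub ?_
    exact Differentiable.diffContOnCl (by fun_prop)
  · intro w hw
    rw [frontier_ball _ hr0.ne'] at hw
    exact hbd w (by simpa using hw)
  · rw [hclosure]
    simpa using hz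

/-! ### Power series of powers of Möbius maps -/

/-- The Möbius map with value `a` and derivative `δ` at `0` and with pole `-1 / c`. -/
noncomputable def complexMobius (a c δ : ℝ) (z : ℂ) : ℂ := a + δ * (z / (1 + c * z))

/-- The coefficient of `z ^ n` in the expansion of `complexMobius a c δ z ^ k`. -/
noncomputable def mobiusPowCoeff (a c δ : ℝ) (k n : ℕ) : ℝ :=
  if n = 0 then a ^ k
  else ∑ l ∈ Finset.Icc 1 (min k n),
    (k.choose l : ℝ) * ((n - 1).choose (l - 1) : ℝ) * a ^ (k - l) * (-c) ^ (n - l) * δ ^ l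

lemma norm_mul_lt_one {c : ℝ} (hc : |c| < 1) {z : ℂ} (hz : ‖z‖ ≤ 1) : ‖(c : ℂ) * z‖ < 1 := by
  rw [norm_mul, Complex.norm_real, Real.norm_eq_abs]
  exact (mul_le_of_le_one_right (abs_nonneg c) hz).trans_lt hc

lemma one_add_mul_ne_zero {c : ℝ} (hc : |c| < 1) {z : ℂ} (hz : ‖z‖ ≤ 1) :
    (1 : ℂ) + c * z ≠ 0 := by
  intro h
  have h1 := norm_mul_lt_one hc hz
  rw [show (c : ℂ) * z = -1 by linear_combination h] at h1
  simp at h1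

/-- The negative binomial series, shifted by `l` by the factor `z ^ l`. -/
lemma hasSum_div_one_add_pow {c : ℝ} (hc : |c| < 1) {z : ℂ} (hz : ‖z‖ ≤ 1) {l : ℕ} (hl : 1 ≤ l) :
    HasSum (fun n => if l ≤ n then ((n - 1).choose (l - 1) : ℂ) * (-c) ^ (n - l) * z ^ n else 0)
      ((z / (1 + c * z)) ^ l) := by
  have h := (hasSum_choose_mul_geometric_of_norm_lt_one (l - 1)
    (r := -((c : ℂ) * z)) (by rw [norm_neg]; exact norm_mul_lt_one hc hz)).mul_left (z ^ l)
  rw [sub_neg_eq_add, Nat.sub_add_cancel hl, mul_one_div, ← div_pow] at h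
  rw [← hasSum_nat_add_iff' l]
  have h0 : ∑ i ∈ Finset.range l,
      (if l ≤ i then ((i - 1).choose (l - 1) : ℂ) * (-c) ^ (i - l) * z ^ i else 0) = 0 :=
    Finset.sum_eq_zero fun i hi => if_neg (by simpa using hi)
  rw [h0, sub_zero]
  refine h.congr_fun fun n => ?_
  rw [if_pos (Nat.le_add_left l n), Nat.add_sub_cancel, Nat.add_sub_assoc hl, pow_add,
    show -((c : ℂ) * z) = -c * z by ring, mul_pow]
  ring

lemma hasSum_complexMobius_pow {a c δ : ℝ} (hc : |c| < 1) {z : ℂ} (hz : ‖z‖ ≤ 1) (k : ℕ) :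
    HasSum (fun n => (mobiusPowCoeff a c δ k n : ℂ) * z ^ n) (complexMobius a c δ z ^ k) := by
  have h1 : complexMobius a c δ z ^ k = (a : ℂ) ^ k + ∑ l ∈ Finset.Icc 1 k,
      (k.choose l : ℂ) * a ^ (k - l) * δ ^ l * (z / (1 + c * z)) ^ l := by
    rw [complexMobius, add_comm, add_pow, Finset.range_eq_Ico, Finset.sum_eq_sum_Ico_succ_bot
      (by lia)]
    simp only [pow_zero, one_mul, Nat.sub_zero, Nat.choose_zero_right, Nat.cast_one, mul_one]
    congr 1
    refine Finset.sum_congr (by ext; simp) fun l _ => ?_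
    rw [mul_pow]
    ring
  have h2 : HasSum (fun n => if n = 0 then (a : ℂ) ^ k else 0) ((a : ℂ) ^ k) :=
    hasSum_ite_eq 0 _
  have h3 := h2.add (hasSum_sum fun l (hl : l ∈ Finset.Icc 1 k) =>
    (hasSum_div_one_add_pow hc hz (Finset.mem_Icc.1 hl).1).mul_left
      ((k.choose l : ℂ) * a ^ (k - l) * δ ^ l))
  rw [h1]
  refine h3.congr_fun fun n => ?_
  rcases Nat.eq_zero_or_pos n with rfl | hn
  · rw [Finset.sum_eq_zero]
    · simp [mobiusPowCoeff]
    · intro l hl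
      rw [if_neg (by have := (Finset.mem_Icc.1 hl).1; lia), mul_zero]
  · simp only [mobiusPowCoeff, if_neg hn.ne', zero_add, mul_ite, mul_zero]
    rw [← Finset.sum_filter]
    push_cast
    rw [Finset.sum_mul]
    refine Finset.sum_congr (by ext; simp; lia) fun l _ => ?_
    ring

/-! ### The truncated transfer operator on polynomials -/

/-- Evaluation of the polynomial with coefficients `ψ 0, …, ψ (m - 1)`. -/
def polyEval {R : Type*} [Semiring R] (m : ℕ) (ψ : ℕ → R) (x : R) : R :=
  ∑ k ∈ Finset.range m, ψ k * x ^ k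

lemma polyEval_ofReal (m : ℕ) (ψ : ℕ → ℝ) (x : ℝ) :
    polyEval m (fun k => (ψ k : ℂ)) x = (polyEval m ψ x : ℝ) := by
  simp [polyEval]

lemma differentiable_polyEval (m : ℕ) (ψ : ℕ → ℂ) : Differentiable ℂ (polyEval m ψ) := by
  unfold polyEval
  fun_prop

section Transfer

variable {I : Type*} [Fintype I]

/-- The Markov operator of a finite family of maps with weights `w`. -/
def markovOp (w : I → ℝ) (f : I → ℝ → ℝ) (g : ℝ → ℝ) (x : ℝ) : ℝ := ∑ i, w i * g (f i x)

/-- The Taylor coefficients of the image of a polynomial under the Markov operator. -/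
noncomputable def transferCoeff (w a c δ : I → ℝ) (m : ℕ) (ψ : ℕ → ℝ) (n : ℕ) : ℝ :=
  ∑ k ∈ Finset.range m, ψ k * ∑ i, w i * mobiusPowCoeff (a i) (c i) (δ i) k n

lemma hasSum_transferCoeff {w a c δ : I → ℝ} (hc : ∀ i, |c i| < 1) (m : ℕ) (ψ : ℕ → ℝ) {z : ℂ}
    (hz : ‖z‖ ≤ 1) :
    HasSum (fun n => (transferCoeff w a c δ m ψ n : ℂ) * z ^ n)
      (∑ i, (w i : ℂ) * polyEval m (fun k => (ψ k : ℂ)) (complexMobius (a i) (c i) (δ i) z)) := by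
  have h := hasSum_sum fun k (_ : k ∈ Finset.range m) =>
    (hasSum_sum fun i (_ : i ∈ Finset.univ) =>
      (hasSum_complexMobius_pow (a := a i) (δ := δ i) (hc i) hz k).mul_left (w i : ℂ)).mul_left
        (ψ k : ℂ)
  convert! h using 1
  · funext n
    simp only [transferCoeff]
    push_cast
    rw [Finset.sum_mul]
    refine Finset.sum_congr rfl fun k _ => ?_
    rw [mul_assoc, Finset.sum_mul]
    congr 1
    exact Finset.sum_congr rfl fun i _ => by ring
  · simp only [polyEval, Finset.mul_sum]
    rw [Finset.sum_comm]
    exact Finset.sum_congr rfl fun k _ => Finset.sum_congr rfl fun i _ => by ring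

lemma norm_sum_weights_le {w : I → ℝ} (hw : ∀ i, 0 ≤ w i) (hw1 : ∑ i, w i = 1) {u : I → ℂ}
    {M : ℝ} (hu : ∀ i, ‖u i‖ ≤ M) : ‖∑ i, (w i : ℂ) * u i‖ ≤ M := by
  calc ‖∑ i, (w i : ℂ) * u i‖ ≤ ∑ i, ‖(w i : ℂ) * u i‖ := norm_sum_le _ _
    _ ≤ ∑ i, w i * M := Finset.sum_le_sum fun i _ => by
        rw [norm_mul, Complex.norm_real, Real.norm_of_nonneg (hw i)]
        exact mul_le_mul_of_nonneg_left (hu i) (hw i)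
    _ = M := by rw [← Finset.sum_mul, hw1, one_mul]

lemma abs_sum_weights_le {w : I → ℝ} (hw : ∀ i, 0 ≤ w i) (hw1 : ∑ i, w i = 1) {u : I → ℝ}
    {M : ℝ} (hu : ∀ i, |u i| ≤ M) : |∑ i, w i * u i| ≤ M := by
  have := norm_sum_weights_le hw hw1 (u := fun i => (u i : ℂ)) (M := M) (by simpa using hu)
  rw [← Real.norm_eq_abs, ← Complex.norm_real]
  simpa using this

/-- The truncation error of one step of the transfer operator. -/
lemma norm_transfer_sub_polyEval_le {w a c δ : I → ℝ} (hw : ∀ i, 0 ≤ w i) (hw1 : ∑ i, w i = 1)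
    (hc : ∀ i, |c i| < 1) {r : ℝ} (hr0 : 0 < r) (hr1 : r < 1)
    (hf : ∀ i, ∀ z : ℂ, ‖z‖ ≤ 1 → ‖complexMobius (a i) (c i) (δ i) z‖ ≤ r)
    {m : ℕ} (hm : 1 ≤ m) {ψ : ℕ → ℝ} {M : ℝ}
    (hM : ∀ z : ℂ, ‖z‖ ≤ r → ‖polyEval m (fun k => (ψ k : ℂ)) z‖ ≤ M) {z : ℂ} (hz : ‖z‖ ≤ r) :
    ‖(∑ i, (w i : ℂ) * polyEval m (fun k => (ψ k : ℂ)) (complexMobius (a i) (c i) (δ i) z))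
        - polyEval m (fun k => (transferCoeff w a c δ m ψ k : ℂ)) z‖
      ≤ M * (r ^ (m - 1) * kernelConst r) := by
  -- The bound `M` is assumed only on the disc of radius `r`, but the maps send the unit disc there,
  -- so the averaged composition is bounded by `M` on the whole unit disc.
  refine norm_taylor_tail_le (g := fun z => ∑ i, (w i : ℂ) *
    polyEval m (fun k => (ψ k : ℂ)) (complexMobius (a i) (c i) (δ i) z)) ?_
    (fun z hz => hasSum_transferCoeff hc m ψ hz)
    (fun z hz => norm_sum_weights_le hw hw1 fun i => hM _ (hf i z hz)) hr0 hr1 hm hz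
  refine DifferentiableOn.diffContOnCl ?_
  rw [closure_ball _ one_ne_zero]
  refine DifferentiableOn.fun_sum fun i _ => DifferentiableOn.const_mul ?_ _
  refine (differentiable_polyEval m _).comp_differentiableOn ?_
  unfold complexMobius
  refine (DifferentiableOn.const_mul (DifferentiableOn.div (by fun_prop) (by fun_prop)
    fun z hz => ?_) _).const_add _
  exact one_add_mul_ne_zero (hc i) (by simpa using hz)

/-- Averaging preserves a sup bound and the discarded Taylor tail adds at most `ρ = r^(m-1) K(r)`
times it, hence growth by `1 + ρ` per step. -/
lemma norm_polyEval_transfer_le {w a c δ : I → ℝ} (hw : ∀ i, 0 ≤ w i) (hw1 : ∑ i, w i = 1)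
    (hc : ∀ i, |c i| < 1) {r : ℝ} (hr0 : 0 < r) (hr1 : r < 1)
    (hf : ∀ i, ∀ z : ℂ, ‖z‖ ≤ 1 → ‖complexMobius (a i) (c i) (δ i) z‖ ≤ r)
    {m : ℕ} (hm : 1 ≤ m) {ψ : ℕ → ℝ} {M : ℝ}
    (hM : ∀ z : ℂ, ‖z‖ ≤ r → ‖polyEval m (fun k => (ψ k : ℂ)) z‖ ≤ M) (j : ℕ) {z : ℂ}
    (hz : ‖z‖ ≤ r) :
    ‖polyEval m (fun k => ((transferCoeff w a c δ m)^[j] ψ k : ℂ)) z‖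
      ≤ M * (1 + r ^ (m - 1) * kernelConst r) ^ j := by
  induction j generalizing z with
  | zero => simpa using hM z hz
  | succ j ih =>
    rw [Function.iterate_succ_apply']
    have h1 := norm_transfer_sub_polyEval_le hw hw1 hc hr0 hr1 hf hm (fun z hz => ih hz) hz
    have h2 := norm_sum_weights_le hw hw1 fun i => ih (hf i z (hz.trans hr1.le))
    have h3 := norm_sub_norm_le
      (polyEval m (fun k => (transferCoeff w a c δ m ((transferCoeff w a c δ m)^[j] ψ) k : ℂ)) z)
      (∑ i, (w i : ℂ) * polyEval m (fun k => ((transferCoeff w a c δ m)^[j] ψ k : ℂ))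
        (complexMobius (a i) (c i) (δ i) z))
    rw [norm_sub_rev] at h3
    calc _ ≤ M * (1 + r ^ (m - 1) * kernelConst r) ^ j
          + M * (1 + r ^ (m - 1) * kernelConst r) ^ j * (r ^ (m - 1) * kernelConst r) := by
          linarith
      _ = _ := by ring

/-- The error of replacing the Markov operator by its truncations. -/
lemma abs_markovOp_iterate_sub_polyEval_le {w a c δ : I → ℝ} {f : I → ℝ → ℝ}
    (hw : ∀ i, 0 ≤ w i) (hw1 : ∑ i, w i = 1)
    (hc : ∀ i, |c i| < 1) {r : ℝ} (hr0 : 0 < r) (hr1 : r < 1)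
    (hf : ∀ i, ∀ z : ℂ, ‖z‖ ≤ 1 → ‖complexMobius (a i) (c i) (δ i) z‖ ≤ r)
    (hfr : ∀ i, ∀ x : ℝ, |x| ≤ 1 → (f i x : ℂ) = complexMobius (a i) (c i) (δ i) x)
    {m : ℕ} (hm : 1 ≤ m) {ψ : ℕ → ℝ} {M : ℝ}
    (hM : ∀ z : ℂ, ‖z‖ ≤ r → ‖polyEval m (fun k => (ψ k : ℂ)) z‖ ≤ M) (j : ℕ) {x : ℝ}
    (hx : |x| ≤ r) :
    |(markovOp w f)^[j] (polyEval m ψ) x - polyEval m ((transferCoeff w a c δ m)^[j] ψ) x|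
      ≤ M * ((1 + r ^ (m - 1) * kernelConst r) ^ j - 1) := by
  have hfr' : ∀ i, ∀ x : ℝ, |x| ≤ r → |f i x| ≤ r := fun i x hx => by
    rw [← Real.norm_eq_abs, ← Complex.norm_real, hfr i x (hx.trans hr1.le)]
    exact hf i x (by simpa using hx.trans hr1.le)
  induction j generalizing x with
  | zero => simp
  | succ j ih =>
    rw [Function.iterate_succ_apply', Function.iterate_succ_apply']
    set q := (transferCoeff w a c δ m)^[j] ψ
    have h1 := norm_transfer_sub_polyEval_le hw hw1 hc hr0 hr1 hf hm
      (fun z hz => norm_polyEval_transfer_le hw hw1 hc hr0 hr1 hf hm hM j hz) (z := x)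
      (by simpa using hx)
    have e1 : (∑ i, (w i : ℂ) * polyEval m (fun k => (q k : ℂ))
        (complexMobius (a i) (c i) (δ i) x)) - polyEval m
          (fun k => (transferCoeff w a c δ m q k : ℂ)) x
        = ((markovOp w f (polyEval m q) x - polyEval m (transferCoeff w a c δ m q) x : ℝ) : ℂ) := by
      rw [polyEval_ofReal, Complex.ofReal_sub, markovOp]
      congr 1
      push_cast
      refine Finset.sum_congr rfl fun i _ => ?_
      rw [← hfr i x (hx.trans hr1.le), polyEval_ofReal]
    rw [e1, Complex.norm_real, Real.norm_eq_abs] at h1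
    have h2 := abs_sum_weights_le hw hw1 fun i => ih (hfr' i x hx)
    have e2 : ∑ i, w i * ((markovOp w f)^[j] (polyEval m ψ) (f i x) - polyEval m q (f i x))
        = markovOp w f ((markovOp w f)^[j] (polyEval m ψ)) x - markovOp w f (polyEval m q) x := by
      simp only [markovOp, mul_sub, Finset.sum_sub_distrib]
    rw [e2] at h2
    -- The old error is averaged, hence not enlarged, and the new truncation adds `M (1+ρ)^j ρ`,
    -- with `ρ = r^(m-1) K(r)`. The total is `M ((1+ρ)^(j+1) - 1)`.
    rw [← sub_add_sub_cancel _ (markovOp w f (polyEval m q) x)]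
    refine (abs_add_le _ _).trans ((add_le_add h2 h1).trans_eq ?_)
    ring

/-- Truncation leaves the constant coefficient alone, so at `0` the last step of the iteration is
free of error. -/
lemma transferCoeff_zero {w a c δ : I → ℝ} {m : ℕ} (ψ : ℕ → ℝ) :
    transferCoeff w a c δ m ψ 0 = ∑ i, w i * polyEval m ψ (a i) := by
  simp only [transferCoeff, mobiusPowCoeff, if_true, polyEval, Finset.mul_sum]
  rw [Finset.sum_comm]
  exact Finset.sum_congr rfl fun i _ => Finset.sum_congr rfl fun k _ => by ring

lemma abs_markovOp_iterate_sub_le {w : I → ℝ} {f : I → ℝ → ℝ}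
    (hw : ∀ i, 0 ≤ w i) (hw1 : ∑ i, w i = 1) {r : ℝ} (hf : ∀ i, ∀ x : ℝ, |x| ≤ r → |f i x| ≤ r)
    {g h : ℝ → ℝ} {M : ℝ} (hM : ∀ x, |x| ≤ r → |g x - h x| ≤ M) (j : ℕ) {x : ℝ} (hx : |x| ≤ r) :
    |(markovOp w f)^[j] g x - (markovOp w f)^[j] h x| ≤ M := by
  induction j generalizing x with
  | zero => exact hM x hx
  | succ j ih =>
    rw [Function.iterate_succ_apply', Function.iterate_succ_apply']
    have h2 := abs_sum_weights_le hw hw1 fun i => ih (hf i x hx)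
    simpa only [markovOp, mul_sub, Finset.sum_sub_distrib] using h2

end Transfer

/-! ### Duality between the kernel matrix and the transfer operator -/

/-- The Taylor coefficients of `log (1 + x)`. -/
noncomputable def logCoeff (k : ℕ) : ℝ := -((-1) ^ k / k)

lemma logCoeff_ne_zero {k : ℕ} (hk : k ≠ 0) : logCoeff k ≠ 0 := by
  have : (k : ℝ) ≠ 0 := Nat.cast_ne_zero.2 hk
  simp [logCoeff, this]

lemma logCoeff_zero : logCoeff 0 = 0 := by simp [logCoeff]

/-- Termwise this is `n C(n-1, l-1) = l C(n, l)`, used for `n` and for `k`: dividing by `n` or by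
`k` exchanges the two kinds of binomial coefficients. The signs match because `(-1)^(k-l)` and
`(-1)^(n-l)` differ by `(-1)^(k+n)`. -/
lemma logCoeff_duality {a c δ : ℝ} {k n : ℕ} (hk : k ≠ 0) (hn : n ≠ 0) :
    (∑ l ∈ Finset.Icc 1 (min k n), (n.choose l : ℝ) * ((k - 1).choose (l - 1) : ℝ) * c ^ (n - l) *
      (-a) ^ (k - l) * δ ^ l) * logCoeff n = logCoeff k * mobiusPowCoeff a c δ k n := by
  rw [mobiusPowCoeff, if_neg hn, Finset.sum_mul, Finset.mul_sum]
  refine Finset.sum_congr rfl fun l hl => ?_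
  rw [Finset.mem_Icc] at hl
  obtain ⟨j, rfl⟩ : ∃ j, l = j + 1 := ⟨l - 1, by lia⟩
  obtain ⟨p, rfl⟩ : ∃ p, k = p + (j + 1) := ⟨k - (j + 1), by lia⟩
  obtain ⟨q, rfl⟩ : ∃ q, n = q + (j + 1) := ⟨n - (j + 1), by lia⟩
  have h1 : ((q + j + 1 : ℕ) : ℝ) * ((q + j).choose j : ℝ)
      = ((q + j + 1).choose (j + 1) : ℝ) * ((j + 1 : ℕ) : ℝ) := by
    exact_mod_cast Nat.add_one_mul_choose_eq (q + j) j
  have h2 : ((p + j + 1 : ℕ) : ℝ) * ((p + j).choose j : ℝ)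
      = ((p + j + 1).choose (j + 1) : ℝ) * ((j + 1 : ℕ) : ℝ) := by
    exact_mod_cast Nat.add_one_mul_choose_eq (p + j) j
  have hj : ((j + 1 : ℕ) : ℝ) ≠ 0 := by positivity
  have hp : ((p + j + 1 : ℕ) : ℝ) ≠ 0 := by positivity
  have hq : ((q + j + 1 : ℕ) : ℝ) ≠ 0 := by positivity
  have ep : p + (j + 1) - (j + 1) = p := by lia
  have eq : q + (j + 1) - (j + 1) = q := by lia
  simp only [logCoeff, ep, eq, Nat.add_sub_cancel]
  simp only [← add_assoc, Nat.add_sub_cancel]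
  rw [eq_comm, ← eq_div_iff hj] at h1 h2
  rw [h1, h2, neg_pow a p, neg_pow c q]
  field_simp
  rw [pow_succ, pow_succ, pow_add, pow_add]
  ring

section Duality

variable {I : Type*} [Fintype I]

/-- The pairing of polynomials with sequences for which `kernelMatrix` is dual to
`transferCoeff`. -/
noncomputable def logPairing (m : ℕ) (ψ y : ℕ → ℝ) : ℝ :=
  ∑ k ∈ Finset.Ico 1 m, ψ k * (y k / logCoeff k)

/-- The Taylor coefficients of `∑ i, w i * log (1 + c i * x)`. -/
noncomputable def avgLogCoeff (w c : I → ℝ) (k : ℕ) : ℝ := logCoeff k * ∑ i, w i * c i ^ k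

lemma applyMatrix_truncate (T : ℕ → ℕ → ℝ) (y : ℕ → ℝ) {m k : ℕ} (hk : k < m) :
    applyMatrix (truncate T m) y k = ∑ n ∈ Finset.range m, T k n * y n := by
  rw [applyMatrix, tsum_eq_sum (s := Finset.range m)]
  · exact Finset.sum_congr rfl fun n hn => by rw [truncate, if_pos ⟨hk, Finset.mem_range.1 hn⟩]
  · intro n hn
    rw [truncate, if_neg (by simp at hn; lia), zero_mul]

variable (A : I → Matrix (Fin 2) (Fin 2) ℝ) (w : I → ℝ)

lemma kernelMatrix_zero_mul_logCoeff {n : ℕ} (hn : n ≠ 0) :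
    kernelMatrix A w 0 n * logCoeff n = avgLogCoeff w (fun i => projT (A i) 0) n := by
  rw [kernelMatrix, if_neg hn, if_pos rfl, avgLogCoeff, mul_comm]

lemma kernelMatrix_mul_logCoeff {k n : ℕ} (hk : k ≠ 0) (hn : n ≠ 0) :
    kernelMatrix A w k n * logCoeff n = logCoeff k * ∑ i, w i *
      mobiusPowCoeff (proj (A i) 0) (projT (A i) 0) (deriv (proj (A i)) 0) k n := by
  rw [kernelMatrix, if_neg hn, if_neg hk, Finset.sum_mul, Finset.mul_sum]
  refine Finset.sum_congr rfl fun i _ => ?_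
  rw [mul_assoc, logCoeff_duality hk hn]
  ring

lemma initVec_eq {k : ℕ} (hk : k ≠ 0) :
    initVec A w k = logCoeff k * ∑ i, w i * proj (A i) 0 ^ k := by
  rw [initVec, Finset.mul_sum]
  refine Finset.sum_congr rfl fun i _ => ?_
  rw [basicVec, if_neg hk, logCoeff, neg_pow (proj (A i) 0)]
  ring

/-- The vector `v` represents the functional `ψ ↦ (Pψ)(0) - ψ(0)`, which is what makes the series
telescope. -/
lemma logPairing_initVec (hw1 : ∑ i, w i = 1) {m : ℕ} (hm : 1 ≤ m) (ψ : ℕ → ℝ) :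
    logPairing m ψ (initVec A w)
      = transferCoeff w (fun i => proj (A i) 0) (fun i => projT (A i) 0)
        (fun i => deriv (proj (A i)) 0) m ψ 0 - ψ 0 := by
  rw [transferCoeff, Finset.range_eq_Ico, Finset.sum_eq_sum_Ico_succ_bot (by lia), logPairing]
  simp only [mobiusPowCoeff, if_true, pow_zero, mul_one, hw1, add_sub_cancel_left]
  refine Finset.sum_congr rfl fun k hk => ?_
  have hk0 : k ≠ 0 := by have := (Finset.mem_Ico.1 hk).1; lia
  rw [initVec_eq A w hk0, mul_div_cancel_left₀ _ (logCoeff_ne_zero hk0)]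

lemma applyMatrix_truncate_zero {m : ℕ} (hm : 1 ≤ m) (y : ℕ → ℝ) :
    applyMatrix (truncate (kernelMatrix A w) m) y 0
      = logPairing m (avgLogCoeff w (fun i => projT (A i) 0)) y := by
  rw [applyMatrix_truncate _ _ (by lia), Finset.range_eq_Ico,
    Finset.sum_eq_sum_Ico_succ_bot (by lia), logPairing]
  rw [show kernelMatrix A w 0 0 = 0 by simp [kernelMatrix], zero_mul, zero_add]
  refine Finset.sum_congr rfl fun k hk => ?_
  have hk0 : k ≠ 0 := by have := (Finset.mem_Ico.1 hk).1; lia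
  rw [← kernelMatrix_zero_mul_logCoeff A w hk0]
  field_simp [logCoeff_ne_zero hk0]

lemma logPairing_applyMatrix_truncate {m : ℕ} (ψ y : ℕ → ℝ) :
    logPairing m ψ (applyMatrix (truncate (kernelMatrix A w) m) y)
      = logPairing m (transferCoeff w (fun i => proj (A i) 0) (fun i => projT (A i) 0)
        (fun i => deriv (proj (A i)) 0) m ψ) y := by
  rcases Nat.eq_zero_or_pos m with rfl | hm
  · simp [logPairing]
  have e1 : ∀ k ∈ Finset.Ico 1 m, ψ k * (applyMatrix (truncate (kernelMatrix A w) m) y k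
      / logCoeff k) = ∑ n ∈ Finset.Ico 1 m, ψ k * (∑ i, w i * mobiusPowCoeff (proj (A i) 0)
        (projT (A i) 0) (deriv (proj (A i)) 0) k n) * (y n / logCoeff n) := by
    intro k hk
    rw [Finset.mem_Ico] at hk
    have hk0 : k ≠ 0 := by lia
    rw [applyMatrix_truncate _ _ hk.2, Finset.range_eq_Ico,
      Finset.sum_eq_sum_Ico_succ_bot (by lia),
      show kernelMatrix A w k 0 = 0 by simp [kernelMatrix], zero_mul, zero_add, Finset.sum_div,
      Finset.mul_sum]
    refine Finset.sum_congr rfl fun n hn => ?_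
    have hn0 : n ≠ 0 := by have := (Finset.mem_Ico.1 hn).1; lia
    have h := kernelMatrix_mul_logCoeff A w hk0 hn0
    rw [mul_comm (logCoeff k), ← eq_div_iff (logCoeff_ne_zero hn0), mul_div_assoc] at h
    rw [h]
    field_simp [logCoeff_ne_zero hk0, logCoeff_ne_zero hn0]
  rw [logPairing, Finset.sum_congr rfl e1, Finset.sum_comm, logPairing]
  refine Finset.sum_congr rfl fun n hn => ?_
  have hn0 : n ≠ 0 := by have := (Finset.mem_Ico.1 hn).1; lia
  -- A constant has no image in positive degrees, so leaving degree `0` out of the pairing loses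
  -- nothing.
  have h0 : ∀ i, mobiusPowCoeff (proj (A i) 0) (projT (A i) 0) (deriv (proj (A i)) 0) 0 n = 0 :=
    fun i => by simp [mobiusPowCoeff, hn0]
  rw [← Finset.sum_mul]
  congr 1
  rw [transferCoeff, Finset.range_eq_Ico, Finset.sum_eq_sum_Ico_succ_bot hm]
  simp only [h0, mul_zero, Finset.sum_const_zero, zero_add]

lemma logPairing_iterate_applyMatrix {m : ℕ} (j : ℕ) (ψ y : ℕ → ℝ) :
    logPairing m ψ ((applyMatrix (truncate (kernelMatrix A w) m))^[j] y)
      = logPairing m ((transferCoeff w (fun i => proj (A i) 0) (fun i => projT (A i) 0)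
        (fun i => deriv (proj (A i)) 0) m)^[j] ψ) y := by
  induction j generalizing ψ with
  | zero => rfl
  | succ j ih =>
    rw [Function.iterate_succ_apply', logPairing_applyMatrix_truncate, ih,
      Function.iterate_succ_apply]

/-- The truncated series telescopes. -/
lemma sum_iterate_applyMatrix_truncate (hw1 : ∑ i, w i = 1) {m : ℕ} (hm : 1 ≤ m) (N : ℕ) :
    ∑ j ∈ Finset.range (N + 1),
      (applyMatrix (truncate (kernelMatrix A w) m))^[j] (initVec A w) 0
      = initVec A w 0 + (transferCoeff w (fun i => proj (A i) 0) (fun i => projT (A i) 0)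
        (fun i => deriv (proj (A i)) 0) m)^[N] (avgLogCoeff w fun i => projT (A i) 0) 0 := by
  induction N with
  | zero => simp [avgLogCoeff, logCoeff_zero]
  | succ N ih =>
    -- Row `0` of the matrix pairs with `φ = avgLogCoeff ..`. Moving `T_m^N` to the other side gives
    -- the pairing of `L^N φ` with `v`, that is `(L^{N+1} φ)_0 - (L^N φ)_0`.
    rw [Finset.sum_range_succ, ih, Function.iterate_succ_apply', applyMatrix_truncate_zero A w hm,
      logPairing_iterate_applyMatrix, logPairing_initVec A w hw1 hm, Function.iterate_succ_apply']
    ring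

end Duality

/-! ### Logarithmic series -/

lemma sum_pow_div_le_neg_log {x : ℝ} (hx0 : 0 ≤ x) (hx1 : x < 1) (m : ℕ) :
    ∑ k ∈ Finset.range m, x ^ k / k ≤ -Real.log (1 - x) := by
  have h := Real.hasSum_pow_div_log_of_abs_lt_one (by rwa [abs_of_nonneg hx0] : |x| < 1)
  rcases m with _ | m
  · rw [Finset.sum_range_zero]
    exact h.nonneg fun n => by positivity
  -- The term `k = 0` is `1 / 0 = 0`.
  rw [Finset.sum_range_succ', Nat.cast_zero, div_zero, add_zero]
  refine le_trans (le_of_eq ?_) (sum_le_hasSum (Finset.range m) (fun n _ => by positivity) h)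
  exact Finset.sum_congr rfl fun n _ => by push_cast; rfl

lemma abs_log_one_add_sub_le {x y : ℝ} (hx : |x| ≤ y) (hy : y < 1) {m : ℕ} (hm : 1 ≤ m) :
    |Real.log (1 + x) - ∑ k ∈ Finset.range m, logCoeff k * x ^ k| ≤ y ^ m / (m * (1 - y)) := by
  obtain ⟨n, rfl⟩ : ∃ n, m = n + 1 := ⟨m - 1, by lia⟩
  have hx1 := hx.trans_lt hy
  have h := Complex.norm_log_sub_logTaylor_le n (z := (x : ℂ)) (by simpa using hx1)
  have e : Complex.log (1 + x) - Complex.logTaylor (n + 1) x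
      = ((Real.log (1 + x) - ∑ k ∈ Finset.range (n + 1), logCoeff k * x ^ k : ℝ) : ℂ) := by
    rw [Complex.ofReal_sub, Complex.ofReal_log (by linarith [neg_abs_le x])]
    congr 1
    · push_cast; rfl
    · simp only [Complex.logTaylor]
      push_cast
      refine Finset.sum_congr rfl fun k _ => ?_
      simp only [logCoeff]
      push_cast
      ring
  rw [e, Complex.norm_real, Complex.norm_real, Real.norm_eq_abs, Real.norm_eq_abs] at h
  refine h.trans ?_
  have h1 : 0 < 1 - y := by linarith
  have h2 : 0 < 1 - |x| := by linarith
  have h3 : 0 ≤ y := (abs_nonneg x).trans hx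
  push_cast
  rw [mul_comm ((n : ℝ) + 1), ← div_div, div_eq_mul_inv (y ^ (n + 1)) (1 - y)]
  gcongr

section AvgLog

variable {I : Type*} [Fintype I] {w c : I → ℝ} {C : ℝ}

/-- The coefficients are at most `C^k / k` in modulus, so the polynomial is dominated by the series
of `-log (1 - rC)`, uniformly in `m`. -/
lemma norm_polyEval_avgLogCoeff_le (hw : ∀ i, 0 ≤ w i) (hw1 : ∑ i, w i = 1)
    (hC : ∀ i, |c i| ≤ C) (hC0 : 0 ≤ C) {r : ℝ} (hrC : r * C < 1) (hr : 0 ≤ r) (m : ℕ) {z : ℂ}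
    (hz : ‖z‖ ≤ r) :
    ‖polyEval m (fun k => (avgLogCoeff w c k : ℂ)) z‖ ≤ Real.log (1 / (1 - r * C)) := by
  rw [one_div, Real.log_inv]
  refine le_trans ?_ (sum_pow_div_le_neg_log (mul_nonneg hr hC0) hrC m)
  refine (norm_sum_le _ _).trans (Finset.sum_le_sum fun k _ => ?_)
  rw [norm_mul, norm_pow, Complex.norm_real, Real.norm_eq_abs, avgLogCoeff, abs_mul]
  have h1 : |logCoeff k| = 1 / k := by simp [logCoeff, abs_div]
  have h2 : |∑ i, w i * c i ^ k| ≤ C ^ k := abs_sum_weights_le hw hw1 fun i => by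
    rw [abs_pow]; gcongr; exact hC i
  rw [h1]
  calc 1 / (k : ℝ) * |∑ i, w i * c i ^ k| * ‖z‖ ^ k ≤ 1 / (k : ℝ) * C ^ k * r ^ k := by gcongr
    _ = (r * C) ^ k / k := by rw [mul_pow]; ring

lemma abs_avgLog_sub_polyEval_le (hw : ∀ i, 0 ≤ w i) (hw1 : ∑ i, w i = 1)
    (hC : ∀ i, |c i| ≤ C) {r : ℝ} (hrC : r * C < 1) (hr : 0 ≤ r) {m : ℕ}
    (hm : 1 ≤ m) {x : ℝ} (hx : |x| ≤ r) :
    |∑ i, w i * Real.log (1 + c i * x) - polyEval m (avgLogCoeff w c) x|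
      ≤ (r * C) ^ m / (m * (1 - r * C)) := by
  have e : polyEval m (avgLogCoeff w c) x
      = ∑ i, w i * ∑ k ∈ Finset.range m, logCoeff k * (c i * x) ^ k := by
    simp only [polyEval, avgLogCoeff, Finset.mul_sum, Finset.sum_mul]
    rw [Finset.sum_comm]
    exact Finset.sum_congr rfl fun i _ => Finset.sum_congr rfl fun k _ => by rw [mul_pow]; ring
  rw [e, ← Finset.sum_sub_distrib]
  simp_rw [← mul_sub]
  refine abs_sum_weights_le hw hw1 fun i => abs_log_one_add_sub_le ?_ hrC hm
  rw [abs_mul, mul_comm]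
  exact mul_le_mul hx (hC i) (abs_nonneg _) hr

end AvgLog

/-! ### Convergence of the Markov operator -/

section Markov

variable {I : Type*} [Fintype I] {w : I → ℝ} {f : I → ℝ → ℝ} {g : ℝ → ℝ} {r K : ℝ}

lemma abs_markovOp_iterate_sub_le_artanh (hw : ∀ i, 0 ≤ w i) (hw1 : ∑ i, w i = 1) (hr0 : 0 ≤ r)
    (hK : 0 ≤ K)
    (hf : ∀ i, ∀ x ∈ Set.Ioo (-1 : ℝ) 1, f i x ∈ Set.Ioo (-1 : ℝ) 1)
    (hcontr : ∀ i, ∀ x ∈ Set.Ioo (-1 : ℝ) 1, ∀ y ∈ Set.Ioo (-1 : ℝ) 1,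
      |Real.artanh (f i x) - Real.artanh (f i y)| ≤ r * |Real.artanh x - Real.artanh y|)
    (hg : ∀ x ∈ Set.Ioo (-1 : ℝ) 1, ∀ y ∈ Set.Ioo (-1 : ℝ) 1,
      |g x - g y| ≤ K * |Real.artanh x - Real.artanh y|) (k : ℕ) {x y : ℝ}
    (hx : x ∈ Set.Ioo (-1 : ℝ) 1) (hy : y ∈ Set.Ioo (-1 : ℝ) 1) :
    |(markovOp w f)^[k] g x - (markovOp w f)^[k] g y|
      ≤ K * r ^ k * |Real.artanh x - Real.artanh y| := by
  induction k generalizing x y with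
  | zero => simpa using hg x hx y hy
  | succ k ih =>
    rw [Function.iterate_succ_apply']
    have h := abs_sum_weights_le hw hw1 fun i => (ih (hf i x hx) (hf i y hy)).trans
      (mul_le_mul_of_nonneg_left (hcontr i x hx y hy) (by positivity))
    simp only [mul_sub, Finset.sum_sub_distrib] at h
    refine h.trans_eq ?_
    ring

/-- The iterates of the Markov operator at `0` converge geometrically. -/
lemma exists_limit_markovOp_iterate (hw : ∀ i, 0 ≤ w i) (hw1 : ∑ i, w i = 1) (hr0 : 0 ≤ r)
    (hr1 : r < 1) (hK : 0 ≤ K)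
    (hf : ∀ i, ∀ x ∈ Set.Ioo (-1 : ℝ) 1, f i x ∈ Set.Ioo (-1 : ℝ) 1)
    (hcontr : ∀ i, ∀ x ∈ Set.Ioo (-1 : ℝ) 1, ∀ y ∈ Set.Ioo (-1 : ℝ) 1,
      |Real.artanh (f i x) - Real.artanh (f i y)| ≤ r * |Real.artanh x - Real.artanh y|)
    (hg : ∀ x ∈ Set.Ioo (-1 : ℝ) 1, ∀ y ∈ Set.Ioo (-1 : ℝ) 1,
      |g x - g y| ≤ K * |Real.artanh x - Real.artanh y|) :
    ∃ l : ℝ, ∀ k, |(markovOp w f)^[k] g 0 - l|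
      ≤ K * (∑ i, w i * |Real.artanh (f i 0)|) * r ^ k / (1 - r) := by
  have h0 : (0 : ℝ) ∈ Set.Ioo (-1 : ℝ) 1 := by simp
  -- `P^{k+1} g (0)` averages `P^k g` over the points `f_i(0)`, so consecutive values differ by the
  -- contracted distances from `0` to these points.
  have hstep : ∀ k, dist ((markovOp w f)^[k] g 0) ((markovOp w f)^[k + 1] g 0)
      ≤ K * (∑ i, w i * |Real.artanh (f i 0)|) * r ^ k := by
    intro k
    rw [Function.iterate_succ_apply', Real.dist_eq, markovOp]
    have e : (markovOp w f)^[k] g 0 - ∑ i, w i * (markovOp w f)^[k] g (f i 0)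
        = ∑ i, w i * ((markovOp w f)^[k] g 0 - (markovOp w f)^[k] g (f i 0)) := by
      simp only [mul_sub, Finset.sum_sub_distrib, ← Finset.sum_mul, hw1, one_mul]
    rw [e, Finset.mul_sum, Finset.sum_mul]
    refine (Finset.abs_sum_le_sum_abs _ _).trans (Finset.sum_le_sum fun i _ => ?_)
    rw [abs_mul, abs_of_nonneg (hw i)]
    have h := abs_markovOp_iterate_sub_le_artanh hw hw1 hr0 hK hf hcontr hg k h0 (hf i 0 h0)
    rw [Real.artanh_zero, zero_sub, abs_neg] at h
    refine (mul_le_mul_of_nonneg_left h (hw i)).trans_eq ?_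
    ring
  obtain ⟨l, hl⟩ := cauchySeq_tendsto_of_complete (cauchySeq_of_le_geometric r _ hr1 hstep)
  exact ⟨l, fun k => dist_le_of_le_geometric_of_tendsto r _ hr1 hstep hl k⟩

lemma abs_artanh_le {x : ℝ} (hr1 : r < 1) (hx : |x| ≤ r) : |Real.artanh x| ≤ Real.artanh r := by
  have hr0 := (abs_nonneg x).trans hx
  rw [abs_le] at *
  rw [← artanh_neg_apply ⟨by linarith, hr1⟩]
  exact ⟨Real.artanh_le_artanh (by linarith) (by linarith) hx.1,
    Real.artanh_le_artanh (by linarith) hr1 hx.2⟩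

/-- A bounded solution of the Poisson equation. -/
lemma exists_poisson_solution {l B : ℝ} (hr0 : 0 ≤ r) (hr1 : r < 1) (hw1 : ∑ i, w i = 1)
    (hf : ∀ i, ∀ x, |x| ≤ r → |f i x| ≤ r)
    (hB : ∀ k, ∀ x, |x| ≤ r → |(markovOp w f)^[k] g x - l| ≤ B * r ^ k) :
    ∃ h : ℝ → ℝ, (∀ x, |x| ≤ r → |h x| ≤ B / (1 - r)) ∧
      ∀ x, |x| ≤ r → h x = g x - l + ∑ i, w i * h (f i x) := by
  have hgeom : HasSum (fun k => B * r ^ k) (B / (1 - r)) := by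
    simpa [div_eq_mul_inv] using (hasSum_geometric_of_lt_one hr0 hr1).mul_left B
  have hsum : ∀ x, |x| ≤ r → Summable fun k => (markovOp w f)^[k] g x - l := fun x hx =>
    Summable.of_norm_bounded hgeom.summable fun k => hB k x hx
  -- The Neumann series `h = ∑ (P^k g - l)`. Splitting off the term `k = 0` is the Poisson equation.
  refine ⟨fun x => ∑' k, ((markovOp w f)^[k] g x - l), fun x hx => ?_, fun x hx => ?_⟩
  · rw [← Real.norm_eq_abs]
    exact tsum_of_norm_bounded hgeom fun k => by simpa using hB k x hx
  · beta_reduce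
    rw [(hsum x hx).tsum_eq_zero_add, Function.iterate_zero, id]
    congr 1
    have h := hasSum_sum fun i (_ : i ∈ Finset.univ) => (hsum _ (hf i x hx)).hasSum.mul_left (w i)
    rw [← h.tsum_eq]
    congr 1
    funext k
    rw [Function.iterate_succ_apply', markovOp]
    simp only [mul_sub, Finset.sum_sub_distrib, ← Finset.sum_mul, hw1, one_mul]

end Markov

/-! ### Products of matrices along a sequence -/

/-- The logarithm of the factor by which `A` scales the mass of the vector with coordinate `x`. -/
noncomputable def logDenom (A : Matrix (Fin 2) (Fin 2) ℝ) (x : ℝ) : ℝ :=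
  Real.log (F A 1 0 * x + F A 1 1)

/-- The orbit of `0` under a sequence of maps. -/
def orbit {I : Type*} (f : I → ℝ → ℝ) (ω : ℕ → I) : ℕ → ℝ
  | 0 => 0
  | n + 1 => f (ω n) (orbit f ω n)

lemma abs_orbit_le {I : Type*} {f : I → ℝ → ℝ} {r : ℝ} (hr : 0 ≤ r)
    (hf : ∀ i, ∀ x, |x| ≤ r → |f i x| ≤ r) (ω : ℕ → I) (n : ℕ) : |orbit f ω n| ≤ r := by
  induction n with
  | zero => simpa [orbit] using hr
  | succ n ih => exact hf _ _ ih

lemma log_entryNorm_matProd {I : Type*} {A : I → Matrix (Fin 2) (Fin 2) ℝ}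
    (hpos : ∀ i a b, 0 < A i a b) (ω : ℕ → I) (n : ℕ) :
    Real.log (entryNorm (matProd A ω n))
      = Real.log 2 + ∑ k ∈ Finset.range n,
        logDenom (A (ω k)) (orbit (fun i => proj (A i)) ω k) := by
  -- The induction also carries that the orbit point is the coordinate of the row-sum vector
  -- `matProd A ω n (1,1)`: difference of its entries over their sum.
  suffices h : (∀ a b, 0 ≤ matProd A ω n a b) ∧ 0 < entryNorm (matProd A ω n) ∧
      orbit (fun i => proj (A i)) ω n * entryNorm (matProd A ω n)
        = (matProd A ω n 0 0 + matProd A ω n 0 1) - (matProd A ω n 1 0 + matProd A ω n 1 1) ∧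
      Real.log (entryNorm (matProd A ω n))
      = Real.log 2 + ∑ k ∈ Finset.range n,
        logDenom (A (ω k)) (orbit (fun i => proj (A i)) ω k) from h.2.2.2
  induction n with
  | zero =>
    have e : entryNorm 1 = 2 := by simp [entryNorm, Fin.sum_univ_two]; norm_num
    refine ⟨fun a b => ?_, ?_, ?_, ?_⟩
    · fin_cases a <;> fin_cases b <;> simp [matProd]
    · simp [matProd, e]
    · simp [matProd, orbit]
    · simp [matProd, e]
  | succ n ih =>
    obtain ⟨h1, h2, h3, h4⟩ := ih
    have hp := hpos (ω n)
    set B := A (ω n) with hB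
    set P := matProd A ω n with hP
    set x := orbit (fun i => proj (A i)) ω n with hx
    have hmul : ∀ a b, matProd A ω (n + 1) a b = B a 0 * P 0 b + B a 1 * P 1 b := fun a b => by
      rw [matProd, Matrix.mul_apply, Fin.sum_univ_two]
    have hnn : ∀ a b, 0 ≤ matProd A ω (n + 1) a b := fun a b => by
      rw [hmul]
      have := hp a 0
      have := hp a 1
      have := h1 0 b
      have := h1 1 b
      positivity
    have hnorm : entryNorm P = P 0 0 + P 0 1 + (P 1 0 + P 1 1) := by
      simp [entryNorm, Fin.sum_univ_two, abs_of_nonneg (h1 _ _)]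
    have hnorm' : entryNorm (matProd A ω (n + 1)) = matProd A ω (n + 1) 0 0
        + matProd A ω (n + 1) 0 1 + (matProd A ω (n + 1) 1 0 + matProd A ω (n + 1) 1 1) := by
      simp [entryNorm, Fin.sum_univ_two, abs_of_nonneg (hnn _ _)]
    have hstep : entryNorm (matProd A ω (n + 1)) = (F B 1 0 * x + F B 1 1) * entryNorm P := by
      rw [hnorm', add_mul, mul_assoc, h3, hnorm, F_apply_one_zero, F_apply_one_one]
      simp only [hmul]
      ring
    have hden : 0 < F B 1 0 * x + F B 1 1 := by
      refine denom_pos (abs_F_one_zero_lt hp) ?_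
      have hR : |x| * entryNorm P ≤ 1 * entryNorm P := by
        rw [← abs_of_pos h2, ← abs_mul, h3, abs_of_pos h2, one_mul, hnorm, abs_le]
        constructor <;> linarith [h1 0 0, h1 0 1, h1 1 0, h1 1 1]
      exact le_of_mul_le_mul_right hR h2
    refine ⟨hnn, by rw [hstep]; positivity, ?_, ?_⟩
    · have e : orbit (fun i => proj (A i)) ω (n + 1) = proj B x := rfl
      rw [e, hstep, proj_apply, ← mul_assoc, div_mul_cancel₀ _ hden.ne', add_mul, mul_assoc, h3,
        hnorm, F_apply_zero_zero, F_apply_zero_one]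
      simp only [hmul]
      ring
    · rw [hstep, Real.log_mul hden.ne' h2.ne', h4, Finset.sum_range_succ, logDenom]
      ring

/-! ### A law of large numbers for random iterations -/

lemma exists_comp_restrict_of_dependsOn {I : Type*} {G : (ℕ → I) → ℝ} {s : Finset ℕ}
    (hG : DependsOn G (s : Set ℕ)) :
    ∃ g : (s → I) → ℝ, G = fun ω => g fun i : s => ω i := by
  obtain ⟨g, hg⟩ := dependsOn_iff_exists_comp.1 hG
  exact ⟨g, hg⟩

/-- Bounded increments make `u n + B n` monotone, and for monotone sequences averages along the
squares suffice because `(n+1)² / n²` tends to `1`. -/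
lemma tendsto_div_of_tendsto_sq {u : ℕ → ℝ} {B : ℝ} (hu : ∀ n, |u (n + 1) - u n| ≤ B)
    (hsq : Tendsto (fun n : ℕ => u (n ^ 2) / ((n ^ 2 : ℕ) : ℝ)) atTop (𝓝 0)) :
    Tendsto (fun n : ℕ => u n / n) atTop (𝓝 0) := by
  have hcancel : ∀ n : ℕ, n ≠ 0 → (u n + B * n) / n = u n / n + B := fun n hn => by
    have : (n : ℝ) ≠ 0 := Nat.cast_ne_zero.2 hn
    field_simp
  have h := tendsto_div_of_monotone_of_exists_subseq_tendsto_div (fun n => u n + B * n) B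
    (monotone_nat_of_le_succ fun n => by
      have := abs_le.1 (hu n)
      push_cast
      linarith) fun a ha => ⟨fun n => n ^ 2, ?_, ?_, ?_⟩
  · have h2 := h.sub_const B
    rw [sub_self] at h2
    refine h2.congr' ?_
    filter_upwards [eventually_ne_atTop 0] with n hn
    rw [hcancel n hn, add_sub_cancel_right]
  · obtain ⟨N, hN⟩ := exists_nat_gt (3 / (a - 1))
    filter_upwards [eventually_ge_atTop (max N 1)] with n hn
    have h1 : (N : ℝ) ≤ n := by exact_mod_cast (le_max_left _ _).trans hn
    have h2 : (1 : ℝ) ≤ n := by exact_mod_cast (le_max_right _ _).trans hn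
    -- This yields `(n+1)² ≤ n² + 3n ≤ a n²` for `n ≥ 1`.
    have h3 : 3 < (a - 1) * n := by
      rw [div_lt_iff₀ (by linarith)] at hN
      nlinarith
    push_cast
    nlinarith
  · exact tendsto_pow_atTop two_ne_zero
  · have h2 := hsq.add_const B
    rw [zero_add] at h2
    refine h2.congr' ?_
    filter_upwards [eventually_ne_atTop 0] with n hn
    rw [hcancel _ (pow_ne_zero 2 hn)]

lemma dependsOn_orbit {I : Type*} {f : I → ℝ → ℝ} (n : ℕ) :
    DependsOn (fun ω : ℕ → I => orbit f ω n) (Finset.range n : Set ℕ) := by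
  induction n with
  | zero => exact fun x y _ => rfl
  | succ n ih =>
    intro x y hxy
    have h1 := ih (x := x) (y := y) fun k hk => hxy k (by simp at hk ⊢; lia)
    simp only [orbit] at h1 ⊢
    rw [h1, hxy n (by simp)]

section Bernoulli

variable {I : Type*} [Fintype I] [MeasurableSpace I] [DiscreteMeasurableSpace I]
  {w : I → ℝ} (hw : ∀ i, 0 < w i) (hw1 : ∑ i, w i = 1)

instance isProbabilityMeasure_bernoulliMeasure :
    IsProbabilityMeasure (bernoulliMeasure w hw hw1) := by
  unfold bernoulliMeasure
  infer_instance

/-- Such a function factors through the finite set `s → I`, so no regularity is needed. -/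
lemma integrable_of_dependsOn {G : (ℕ → I) → ℝ} {s : Finset ℕ} (hG : DependsOn G (s : Set ℕ)) :
    Integrable G (bernoulliMeasure w hw hw1) := by
  obtain ⟨g, rfl⟩ := exists_comp_restrict_of_dependsOn hG
  have hm : Measurable fun ω : ℕ → I => fun i : s => ω i := by fun_prop
  exact (Integrable.of_finite (f := g)).comp_measurable hm

lemma integral_indicator_eval [DecidableEq I] (n : ℕ) (i : I) :
    ∫ ω, (if ω n = i then (1 : ℝ) else 0) ∂(bernoulliMeasure w hw hw1) = w i := by
  have hmp : MeasurePreserving (Function.eval n) (bernoulliMeasure w hw hw1)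
      (weightPMF w hw hw1).toMeasure := measurePreserving_eval_infinitePi _ n
  have h := integral_map (μ := bernoulliMeasure w hw hw1) hmp.measurable.aemeasurable
    (f := fun j : I => if j = i then (1 : ℝ) else 0)
    (measurable_of_finite _).aestronglyMeasurable
  rw [hmp.map_eq] at h
  rw [show (∫ ω, (if ω n = i then (1 : ℝ) else 0) ∂(bernoulliMeasure w hw hw1))
    = ∫ ω, (if Function.eval n ω = i then (1 : ℝ) else 0) ∂(bernoulliMeasure w hw hw1) from rfl,
    ← h, integral_fintype (Integrable.of_finite), Finset.sum_eq_single i]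
  · rw [if_pos rfl, smul_eq_mul, mul_one, Measure.real,
      PMF.toMeasure_apply_singleton _ _ (measurableSet_singleton i)]
    simp [weightPMF, (hw i).le]
  · intro j _ hj
    simp [hj]
  · simp

/-- A function of the past is uncorrelated with the present. -/
lemma integral_mul_indicator_eval [DecidableEq I] {G : (ℕ → I) → ℝ} {n : ℕ}
    (hG : DependsOn G (Finset.range n : Set ℕ)) (i : I) :
    ∫ ω, G ω * (if ω n = i then (1 : ℝ) else 0) ∂(bernoulliMeasure w hw hw1)
      = w i * ∫ ω, G ω ∂(bernoulliMeasure w hw hw1) := by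
  obtain ⟨g, hg⟩ := exists_comp_restrict_of_dependsOn hG
  have hind : ProbabilityTheory.iIndepFun (fun (k : ℕ) (ω : ℕ → I) => ω k)
      (bernoulliMeasure w hw hw1) :=
    ProbabilityTheory.iIndepFun_infinitePi (P := fun _ : ℕ => (weightPMF w hw hw1).toMeasure)
      (X := fun _ (j : I) => j) fun _ => measurable_id
  have h2 := hind.indepFun_finset (Finset.range n) {n} (by simp) fun k => measurable_pi_apply k
  have h3 := h2.comp (measurable_of_finite g)
    (measurable_of_finite fun u : ({n} : Finset ℕ) → I =>
      if u ⟨n, Finset.mem_singleton_self n⟩ = i then (1 : ℝ) else 0)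
  have h4 := h3.integral_fun_mul_eq_mul_integral
    (((measurable_of_finite g).comp (by fun_prop)).aestronglyMeasurable)
    (((measurable_of_finite _).comp (by fun_prop)).aestronglyMeasurable)
  simp only [Function.comp_def] at h4
  rw [hg, h4, integral_indicator_eval hw hw1, mul_comm]

/-- Martingale increments are orthogonal to the past. -/
lemma integral_mul_eq_zero_of_dependsOn {G : (ℕ → I) → ℝ} {Ψ : I → (ℕ → I) → ℝ} {n : ℕ}
    (hG : DependsOn G (Finset.range n : Set ℕ))
    (hΨ : ∀ i, DependsOn (Ψ i) (Finset.range n : Set ℕ)) (h0 : ∀ ω, ∑ i, w i * Ψ i ω = 0) :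
    ∫ ω, G ω * Ψ (ω n) ω ∂(bernoulliMeasure w hw hw1) = 0 := by
  classical
  have hGΨ : ∀ i, DependsOn (fun ω => G ω * Ψ i ω) (Finset.range n : Set ℕ) :=
    fun i x y hxy => by simp only [hG hxy, hΨ i hxy]
  -- Splitting by the value of the present symbol leaves coefficients that depend on the past alone.
  have e : ∀ ω : ℕ → I, G ω * Ψ (ω n) ω
      = ∑ i, (G ω * Ψ i ω) * (if ω n = i then (1 : ℝ) else 0) := by
    intro ω
    simp
  simp_rw [e]
  rw [integral_finsetSum]
  · simp_rw [integral_mul_indicator_eval hw hw1 (hGΨ _), ← integral_const_mul]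
    rw [← integral_finsetSum]
    · have : ∀ ω : ℕ → I, ∑ i, w i * (G ω * Ψ i ω) = 0 := fun ω => by
        rw [← mul_zero (G ω), ← h0 ω, Finset.mul_sum]
        exact Finset.sum_congr rfl fun i _ => by ring
      simp_rw [this]
      simp
    · exact fun i _ => (integrable_of_dependsOn hw hw1 (hGΨ i)).const_mul _
  · intro i _
    refine integrable_of_dependsOn hw hw1 (s := Finset.range (n + 1)) fun x y hxy => ?_
    have h1 := hGΨ i (x := x) (y := y) fun k hk => hxy k (by simp at hk ⊢; lia)
    have h2 : x n = y n := hxy n (by simp)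
    simp only at h1
    rw [h1, h2]

/-- Second moment of a martingale with bounded increments. -/
lemma integral_sq_martingale_le {Ψ : ℕ → I → (ℕ → I) → ℝ} {B : ℝ}
    (hΨ : ∀ n i, DependsOn (Ψ n i) (Finset.range n : Set ℕ))
    (h0 : ∀ n ω, ∑ i, w i * Ψ n i ω = 0) (hB : ∀ n i ω, |Ψ n i ω| ≤ B) (n : ℕ) :
    DependsOn (fun ω => ∑ k ∈ Finset.range n, Ψ k (ω k) ω) (Finset.range n : Set ℕ) ∧
    ∫ ω, (∑ k ∈ Finset.range n, Ψ k (ω k) ω) ^ 2 ∂(bernoulliMeasure w hw hw1) ≤ n * B ^ 2 := by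
  have hdep : ∀ n, DependsOn (fun ω => ∑ k ∈ Finset.range n, Ψ k (ω k) ω)
      (Finset.range n : Set ℕ) := by
    intro n x y hxy
    refine Finset.sum_congr rfl fun k hk => ?_
    have hk := Finset.mem_range.1 hk
    rw [hxy k (by simpa using hk)]
    exact hΨ k _ fun j hj => hxy j (by simp at hj ⊢; lia)
  refine ⟨hdep n, ?_⟩
  induction n with
  | zero => simp
  | succ n ih =>
    set M := fun ω : ℕ → I => ∑ k ∈ Finset.range n, Ψ k (ω k) ω with hM
    have hdepD : DependsOn (fun ω : ℕ → I => Ψ n (ω n) ω) (Finset.range (n + 1) : Set ℕ) := by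
      intro x y hxy
      simp only
      rw [hxy n (by simp)]
      exact hΨ n _ fun j hj => hxy j (by simp at hj ⊢; lia)
    have hdepM : DependsOn M (Finset.range (n + 1) : Set ℕ) := fun x y hxy =>
      hdep n fun j hj => hxy j (by simp at hj ⊢; lia)
    have i1 : Integrable (fun ω => M ω ^ 2) (bernoulliMeasure w hw hw1) :=
      integrable_of_dependsOn hw hw1 (s := Finset.range (n + 1)) fun x y hxy => by simp only [hdepM hxy]
    have i2 : Integrable (fun ω => 2 * (M ω * Ψ n (ω n) ω)) (bernoulliMeasure w hw hw1) :=
      integrable_of_dependsOn hw hw1 (s := Finset.range (n + 1)) fun x y hxy => by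
        have h1 := hdepD hxy
        simp only at h1
        simp only [hdepM hxy, h1]
    have i3 : Integrable (fun ω => Ψ n (ω n) ω ^ 2) (bernoulliMeasure w hw hw1) :=
      integrable_of_dependsOn hw hw1 (s := Finset.range (n + 1)) fun x y hxy => by
        have h1 := hdepD hxy
        simp only at h1
        simp only [h1]
    have e : ∀ ω : ℕ → I, (∑ k ∈ Finset.range (n + 1), Ψ k (ω k) ω) ^ 2
        = M ω ^ 2 + 2 * (M ω * Ψ n (ω n) ω) + Ψ n (ω n) ω ^ 2 := fun ω => by
      rw [Finset.sum_range_succ]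
      ring
    simp_rw [e]
    rw [integral_add (i1.fun_add i2) i3, integral_add i1 i2, integral_const_mul,
      integral_mul_eq_zero_of_dependsOn hw hw1 (hdep n) (hΨ n) (h0 n)]
    have h3 : ∫ ω, Ψ n (ω n) ω ^ 2 ∂(bernoulliMeasure w hw hw1) ≤ B ^ 2 := by
      have := integral_mono i3 (integrable_const (B ^ 2)) fun ω => by
        have := hB n (ω n) ω
        exact sq_le_sq' (by linarith [neg_abs_le (Ψ n (ω n) ω)]) (by linarith [le_abs_self (Ψ n (ω n) ω)])
      simpa using this
    push_cast
    linarith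

/-- The law of large numbers for martingales with bounded increments. -/
lemma ae_tendsto_martingale_div {Ψ : ℕ → I → (ℕ → I) → ℝ} {B : ℝ}
    (hΨ : ∀ n i, DependsOn (Ψ n i) (Finset.range n : Set ℕ))
    (h0 : ∀ n ω, ∑ i, w i * Ψ n i ω = 0) (hB : ∀ n i ω, |Ψ n i ω| ≤ B) :
    ∀ᵐ ω ∂(bernoulliMeasure w hw hw1),
      Tendsto (fun n : ℕ => (∑ k ∈ Finset.range n, Ψ k (ω k) ω) / n) atTop (𝓝 0) := by
  set M : ℕ → (ℕ → I) → ℝ := fun n ω => ∑ k ∈ Finset.range n, Ψ k (ω k) ω with hM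
  let X : ℕ → (ℕ → I) → ℝ := fun j ω => (M ((j + 1) ^ 2) ω / (((j + 1) ^ 2 : ℕ) : ℝ)) ^ 2
  have hXi : ∀ j, Integrable (X j) (bernoulliMeasure w hw hw1) := fun j =>
    integrable_of_dependsOn hw hw1 (s := Finset.range ((j + 1) ^ 2)) fun x y hxy => by
      have h := (integral_sq_martingale_le hw hw1 hΨ h0 hB ((j + 1) ^ 2)).1 hxy
      simp only at h
      simp only [X, hM, h]
  have hXint : ∀ j, ∫ ω, X j ω ∂(bernoulliMeasure w hw hw1) ≤ B ^ 2 * (1 / ((j + 1 : ℕ) : ℝ) ^ 2) := by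
    intro j
    have h := (integral_sq_martingale_le hw hw1 hΨ h0 hB ((j + 1) ^ 2)).2
    simp only [X, div_pow, integral_div]
    rw [div_le_iff₀ (by positivity)]
    refine h.trans_eq ?_
    push_cast
    field_simp
  have hsum : Summable fun j : ℕ => B ^ 2 * (1 / ((j + 1 : ℕ) : ℝ) ^ 2) :=
    ((summable_nat_add_iff 1).2 (Real.summable_one_div_nat_pow.2 one_lt_two)).mul_left _
  -- At time `(j+1)²` the normalized second moment is at most `B² / (j+1)²`, a summable bound. Hence
  -- `∑ X j` is almost surely finite and its terms tend to `0`.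
  have hfin : ∫⁻ ω, ∑' j, ENNReal.ofReal (X j ω) ∂(bernoulliMeasure w hw hw1) ≠ ⊤ := by
    rw [lintegral_tsum fun j => (hXi j).aemeasurable.ennreal_ofReal]
    have : ∀ j, ∫⁻ ω, ENNReal.ofReal (X j ω) ∂(bernoulliMeasure w hw hw1)
        ≤ ENNReal.ofReal (B ^ 2 * (1 / ((j + 1 : ℕ) : ℝ) ^ 2)) := fun j => by
      rw [← ofReal_integral_eq_lintegral_ofReal (hXi j)
        (Eventually.of_forall fun ω => sq_nonneg _)]
      exact ENNReal.ofReal_le_ofReal (hXint j)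
    refine ne_top_of_le_ne_top ?_ (ENNReal.tsum_le_tsum this)
    rw [← ENNReal.ofReal_tsum_of_nonneg (fun j => by positivity) hsum]
    exact ENNReal.ofReal_ne_top
  have hae := ae_lt_top' (AEMeasurable.tsum fun j =>
    (hXi j).aemeasurable.ennreal_ofReal) hfin
  filter_upwards [hae] with ω hω
  have ht := ENNReal.tendsto_atTop_zero_of_tsum_ne_top hω.ne
  refine tendsto_div_of_tendsto_sq (u := fun n => M n ω) (B := B) (fun n => ?_) ?_
  · simp only [hM, Finset.sum_range_succ, add_sub_cancel_left]
    exact hB _ _ _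
  · rw [← tendsto_add_atTop_iff_nat 1]
    have h1 : Tendsto (fun j => X j ω) atTop (𝓝 0) := by
      have := (ENNReal.tendsto_toReal ENNReal.zero_ne_top).comp ht
      simpa [Function.comp_def, X, ENNReal.toReal_ofReal, sq_nonneg] using this
    have h2 := h1.sqrt
    rw [Real.sqrt_zero] at h2
    rw [tendsto_zero_iff_abs_tendsto_zero]
    refine h2.congr fun j => ?_
    simp only [X, Real.sqrt_sq_eq_abs, Function.comp_apply]

/-- Birkhoff averages along random iterations converge as soon as the Poisson equation has a bounded
solution. -/
theorem ae_tendsto_average_orbit {f ψ : I → ℝ → ℝ} {h : ℝ → ℝ} {r l B₁ B₂ : ℝ} (hr : 0 ≤ r)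
    (hf : ∀ i, ∀ x, |x| ≤ r → |f i x| ≤ r) (hψ : ∀ i, ∀ x, |x| ≤ r → |ψ i x| ≤ B₁)
    (hh : ∀ x, |x| ≤ r → |h x| ≤ B₂)
    (hpoisson : ∀ x, |x| ≤ r → h x = (∑ i, w i * ψ i x) - l + ∑ i, w i * h (f i x)) :
    ∀ᵐ ω ∂(bernoulliMeasure w hw hw1), Tendsto (fun n : ℕ =>
      (∑ k ∈ Finset.range n, ψ (ω k) (orbit f ω k)) / n) atTop (𝓝 l) := by
  -- The Poisson equation says that these increments have conditional mean zero. Their `h` part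
  -- telescopes to a bounded term.
  let Ψ : ℕ → I → (ℕ → I) → ℝ := fun n i ω =>
    ψ i (orbit f ω n) - l + h (f i (orbit f ω n)) - h (orbit f ω n)
  have horb := fun (ω : ℕ → I) n => abs_orbit_le hr hf ω n
  have key := ae_tendsto_martingale_div hw hw1 (Ψ := Ψ) (B := B₁ + |l| + B₂ + B₂)
    (fun n i x y hxy => by
      have h1 := dependsOn_orbit (f := f) n hxy
      simp only at h1
      simp only [Ψ, h1])
    (fun n ω => by
      have h1 := hpoisson _ (horb ω n)
      simp only [Ψ, mul_sub, mul_add, Finset.sum_sub_distrib, Finset.sum_add_distrib,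
        ← Finset.sum_mul, hw1, one_mul]
      linarith)
    (fun n i ω => by
      have hx := horb ω n
      have h1 := abs_le.1 (hψ i _ hx)
      have h2 := abs_le.1 (hh _ hx)
      have h3 := abs_le.1 (hh _ (hf i _ hx))
      have h4 := neg_abs_le l
      have h5 := le_abs_self l
      simp only [Ψ]
      rw [abs_le]
      constructor <;> linarith)
  filter_upwards [key] with ω hω
  have hbdd : Tendsto (fun n : ℕ => (h (orbit f ω n) - h (orbit f ω 0)) / n) atTop (𝓝 0) := by
    refine squeeze_zero_norm (a := fun n : ℕ => 2 * B₂ / n) (fun n => ?_)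
      (tendsto_const_div_atTop_nhds_zero_nat _)
    rw [norm_div, Real.norm_natCast, Real.norm_eq_abs]
    have h1 := abs_le.1 (hh _ (horb ω n))
    have h2 := abs_le.1 (hh _ (horb ω 0))
    gcongr
    rw [abs_le]
    constructor <;> linarith
  have hlim := (hω.sub hbdd).add_const l
  rw [sub_zero, zero_add] at hlim
  refine hlim.congr' ?_
  filter_upwards [eventually_ne_atTop 0] with n hn
  have hn' : (n : ℝ) ≠ 0 := Nat.cast_ne_zero.2 hn
  have e : ∑ k ∈ Finset.range n, Ψ k (ω k) ω = (∑ k ∈ Finset.range n, ψ (ω k) (orbit f ω k))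
      - n * l + (h (orbit f ω n) - h (orbit f ω 0)) := by
    rw [← Finset.sum_range_sub (fun k => h (orbit f ω k))]
    simp only [Ψ, orbit, Finset.sum_sub_distrib, Finset.sum_add_distrib, Finset.sum_const,
      Finset.card_range, nsmul_eq_mul]
    ring
  rw [e]
  field_simp
  ring

end Bernoulli

/-! ### Assembling the estimate -/

lemma complexMobius_eq_div {A : Matrix (Fin 2) (Fin 2) ℝ} (hA : ∀ a b, 0 < A a b) {z : ℂ}
    (hz : ‖z‖ ≤ 1) :
    (F A 1 0 : ℂ) * z + F A 1 1 ≠ 0 ∧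
    complexMobius (proj A 0) (projT A 0) (deriv (proj A) 0) z
      = ((F A 0 0 : ℂ) * z + F A 0 1) / ((F A 1 0 : ℂ) * z + F A 1 1) := by
  have hd := F_one_one_pos hA
  have hd' : (F A 1 1 : ℂ) ≠ 0 := by exact_mod_cast hd.ne'
  have h1 := one_add_mul_ne_zero (abs_projT_zero_lt_one hA) hz
  have e : (F A 1 0 : ℂ) * z + F A 1 1 = F A 1 1 * (1 + (projT A 0 : ℂ) * z) := by
    rw [projT_zero]
    push_cast
    field_simp
    ring
  have hne : (F A 1 0 : ℂ) * z + F A 1 1 ≠ 0 := by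
    rw [e]
    exact mul_ne_zero hd' h1
  refine ⟨hne, ?_⟩
  have e2 : (1 + (projT A 0 : ℂ) * z) = ((F A 1 0 : ℂ) * z + F A 1 1) / F A 1 1 := by
    rw [e, mul_div_cancel_left₀ _ hd']
  rw [complexMobius, e2, proj_zero, deriv_proj_zero hd.ne', Matrix.det_fin_two]
  push_cast
  field_simp
  ring

lemma norm_complexMobius_le {A : Matrix (Fin 2) (Fin 2) ℝ} (hA : ∀ a b, 0 < A a b) {r : ℝ}
    (hr0 : 0 ≤ r) (hr : Set.MapsTo (proj A) (Set.Icc (-1) 1) (Set.Icc (-r) r)) {z : ℂ}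
    (hz : ‖z‖ ≤ 1) : ‖complexMobius (proj A 0) (projT A 0) (deriv (proj A) 0) z‖ ≤ r := by
  obtain ⟨h1, h2⟩ := complexMobius_eq_div hA hz
  obtain ⟨b1, b2⟩ := proj_mem_bounds hA hr
  rw [h2, norm_div, div_le_iff₀ (norm_pos_iff.2 h1)]
  exact norm_le_of_abs_le b1 b2 (abs_F_one_zero_lt hA) hr0 hz

lemma ofReal_proj {A : Matrix (Fin 2) (Fin 2) ℝ} (hA : ∀ a b, 0 < A a b) {x : ℝ}
    (hx : |x| ≤ 1) :
    (proj A x : ℂ) = complexMobius (proj A 0) (projT A 0) (deriv (proj A) 0) x := by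
  rw [(complexMobius_eq_div hA (z := x) (by simpa using hx)).2, proj_apply]
  push_cast
  rfl

lemma logDenom_eq {A : Matrix (Fin 2) (Fin 2) ℝ} (hA : ∀ a b, 0 < A a b) (x : ℝ) :
    logDenom A x = Real.log (F A 1 1 * (1 + projT A 0 * x)) := by
  have hd := (F_one_one_pos hA).ne'
  rw [logDenom, projT_zero]
  congr 1
  field_simp
  ring

lemma logDenom_eq_add {A : Matrix (Fin 2) (Fin 2) ℝ} (hA : ∀ a b, 0 < A a b) {x : ℝ}
    (hx : |x| ≤ 1) : logDenom A x = Real.log (F A 1 1) + Real.log (1 + projT A 0 * x) := by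
  have := denom_pos (abs_projT_zero_lt_one hA) hx
  rw [logDenom_eq hA, Real.log_mul (F_one_one_pos hA).ne' (by linarith)]

section Family

variable {I : Type*} [Fintype I] {A : I → Matrix (Fin 2) (Fin 2) ℝ} {w : I → ℝ}

/-- Since `f_i'(0) = det F(A_i) / F(A_i)₁₁²`, the logarithm in `v_0` is that of `F(A_i)₁₁²`. -/
lemma initVec_zero (hpos : ∀ i a b, 0 < A i a b) (hdet : ∀ i, (A i).det ≠ 0) :
    initVec A w 0 = ∑ i, w i * Real.log (F (A i) 1 1) := by
  rw [initVec]
  refine Finset.sum_congr rfl fun i _ => ?_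
  have hd := F_one_one_pos (hpos i)
  have hdet' : (F (A i)).det ≠ 0 := by rw [det_F]; exact hdet i
  rw [basicVec, if_pos rfl, deriv_proj_zero hd.ne', div_div_cancel₀ hdet', Real.log_pow]
  push_cast
  ring

lemma abs_projT_le_maxT (i : I) : |projT (A i) 0| ≤ maxT A :=
  le_ciSup (f := fun i => |projT (A i) 0|) (Set.finite_range _).bddAbove i

lemma maxT_nonneg {I : Type*} {A : I → Matrix (Fin 2) (Fin 2) ℝ} : 0 ≤ maxT A := Real.iSup_nonneg fun _ => abs_nonneg _

lemma maxT_lt_one [Nonempty I] (hpos : ∀ i a b, 0 < A i a b) : maxT A < 1 := by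
  obtain ⟨i, hi⟩ := exists_eq_ciSup_of_finite (f := fun i => |projT (A i) 0|)
  rw [maxT, ← hi]
  exact abs_projT_zero_lt_one (hpos i)

lemma markovOp_iterate_const_add {f : I → ℝ → ℝ} (hw1 : ∑ i, w i = 1) (c : ℝ) (g : ℝ → ℝ)
    (k : ℕ) (x : ℝ) :
    (markovOp w f)^[k] (fun x => c + g x) x = c + (markovOp w f)^[k] g x := by
  induction k generalizing x with
  | zero => rfl
  | succ k ih =>
    rw [Function.iterate_succ_apply', Function.iterate_succ_apply', markovOp, markovOp]
    simp only [ih, mul_add, Finset.sum_add_distrib, ← Finset.sum_mul, hw1, one_mul]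

/-- The effect of truncation on a partial sum of the series. -/
lemma abs_markovOp_iterate_sub_truncated_sum_le (hpos : ∀ i a b, 0 < A i a b)
    (hdet : ∀ i, (A i).det ≠ 0) (hw : ∀ i, 0 ≤ w i) (hw1 : ∑ i, w i = 1) {r : ℝ} (hr0 : 0 < r)
    (hr1 : r < 1) (hr : ∀ i, Set.MapsTo (proj (A i)) (Set.Icc (-1) 1) (Set.Icc (-r) r))
    {m : ℕ} (hm : 1 ≤ m) (hrC : r * maxT A < 1) (N : ℕ) :
    |(markovOp w fun i => proj (A i))^[N + 1] (fun x => ∑ i, w i * logDenom (A i) x) 0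
        - ∑ j ∈ Finset.range (N + 2),
          (applyMatrix (truncate (kernelMatrix A w) m))^[j] (initVec A w) 0|
      ≤ Real.log (1 / (1 - r * maxT A)) * ((1 + r ^ (m - 1) * kernelConst r) ^ N - 1)
        + (r * maxT A) ^ m / (m * (1 - r * maxT A)) := by
  have hfr : ∀ i, ∀ x, |x| ≤ r → |proj (A i) x| ≤ r := fun i x hx =>
    abs_le.2 (hr i (abs_le.1 (hx.trans hr1.le)))
  have h0 : |(0 : ℝ)| ≤ r := by simpa using hr0.le
  have hlog : ∀ x, |x| ≤ r → |(∑ i, w i * logDenom (A i) x)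
      - (initVec A w 0 + polyEval m (avgLogCoeff w fun i => projT (A i) 0) x)|
      ≤ (r * maxT A) ^ m / (m * (1 - r * maxT A)) := by
    intro x hx
    have h := abs_avgLog_sub_polyEval_le hw hw1 (abs_projT_le_maxT (A := A)) hrC hr0.le hm hx
    rw [initVec_zero hpos hdet]
    simp_rw [logDenom_eq_add (hpos _) (hx.trans hr1.le), mul_add, Finset.sum_add_distrib]
    rwa [add_sub_add_left_eq_sub]
  have h1 := abs_markovOp_iterate_sub_le hw hw1 hfr hlog (N + 1) h0
  rw [markovOp_iterate_const_add hw1 (initVec A w 0)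
    (polyEval m (avgLogCoeff w fun i => projT (A i) 0))] at h1
  rw [sum_iterate_applyMatrix_truncate A w hw1 hm (N + 1)]
  have h2 : |(markovOp w fun i => proj (A i))^[N + 1]
      (polyEval m (avgLogCoeff w fun i => projT (A i) 0)) 0
      - (transferCoeff w (fun i => proj (A i) 0) (fun i => projT (A i) 0)
        (fun i => deriv (proj (A i)) 0) m)^[N + 1] (avgLogCoeff w fun i => projT (A i) 0) 0|
      ≤ Real.log (1 / (1 - r * maxT A)) * ((1 + r ^ (m - 1) * kernelConst r) ^ N - 1) := by
    -- Only the constant coefficient is compared, so the last step is exact and the exponent is `N`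
    -- instead of `N + 1`.
    rw [Function.iterate_succ_apply', Function.iterate_succ_apply', transferCoeff_zero, markovOp,
      ← Finset.sum_sub_distrib]
    simp_rw [← mul_sub]
    refine abs_sum_weights_le hw hw1 fun i => ?_
    exact abs_markovOp_iterate_sub_polyEval_le hw hw1
      (fun i => abs_projT_zero_lt_one (hpos i)) hr0 hr1
      (fun i z hz => norm_complexMobius_le (hpos i) hr0.le (hr i) hz)
      (fun i x hx => ofReal_proj (hpos i) hx) hm
      (fun z hz => norm_polyEval_avgLogCoeff_le hw hw1 abs_projT_le_maxT maxT_nonneg hrC hr0.le m hz)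
      N (hfr i 0 h0)
  rw [abs_le] at *
  constructor <;> linarith

end Family

/-- The elementary comparison of error terms. -/
lemma pow_sub_one_le_div {ρ : ℝ} (hρ : 0 < ρ) (N : ℕ) :
    (1 + ρ) ^ N - 1 ≤ ((1 + ρ) ^ (N + 1) - 1 - ((N : ℝ) + 1) * ρ) / ρ := by
  -- The right side is `∑_{j≤N} ((1+ρ)^j - 1)`, whose last term is the left side. After clearing `ρ`
  -- the gap is Bernoulli's inequality.
  rw [le_div_iff₀ hρ, pow_succ]
  have := one_add_mul_le_pow (by linarith : -2 ≤ ρ) N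
  nlinarith

section Exponent

variable {I : Type*} [Fintype I] {A : I → Matrix (Fin 2) (Fin 2) ℝ} {w : I → ℝ}

/-- Geometric convergence to the top Lyapunov exponent. -/
lemma exists_isTopLyapunovExponent [MeasurableSpace I] [DiscreteMeasurableSpace I]
    (hpos : ∀ i a b, 0 < A i a b) (hw : ∀ i, 0 < w i)
    (hw1 : ∑ i, w i = 1) {r : ℝ} (hr0 : 0 < r) (hr1 : r < 1)
    (hr : ∀ i, Set.MapsTo (proj (A i)) (Set.Icc (-1) 1) (Set.Icc (-r) r)) :
    ∃ lam : ℝ, IsTopLyapunovExponent A w hw hw1 lam ∧ ∀ k,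
      |(markovOp w fun i => proj (A i))^[k] (fun x => ∑ i, w i * logDenom (A i) x) 0 - lam|
        ≤ tailConst A w r * r ^ k := by
  have hw0 : ∀ i, 0 ≤ w i := fun i => (hw i).le
  set κ := ∑ i, w i * (|projT (A i) 0| / (1 + √(1 - |projT (A i) 0| ^ 2))) with hκ
  have hκ0 : 0 ≤ κ := Finset.sum_nonneg fun i _ => mul_nonneg (hw0 i) (by positivity)
  have hfr : ∀ i, ∀ x, |x| ≤ 1 → |proj (A i) x| ≤ r := fun i x hx =>
    abs_le.2 (hr i (abs_le.1 hx))
  have hIoo : ∀ {x : ℝ}, |x| ≤ r → x ∈ Set.Ioo (-1 : ℝ) 1 := fun hx =>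
    abs_lt_one_of_mem_Icc hr1 (abs_le.1 hx)
  have hIoo' : ∀ {x : ℝ}, x ∈ Set.Ioo (-1 : ℝ) 1 → |x| ≤ 1 := fun hx =>
    (abs_lt.2 hx).le
  have hf : ∀ i, ∀ x ∈ Set.Ioo (-1 : ℝ) 1, proj (A i) x ∈ Set.Ioo (-1 : ℝ) 1 :=
    fun i x hx => hIoo (hfr i x (hIoo' hx))
  have hcontr : ∀ i, ∀ x ∈ Set.Ioo (-1 : ℝ) 1, ∀ y ∈ Set.Ioo (-1 : ℝ) 1,
      |Real.artanh (proj (A i) x) - Real.artanh (proj (A i) y)|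
        ≤ r * |Real.artanh x - Real.artanh y| := fun i x hx y hy =>
    abs_artanh_proj_sub_le (hpos i) hr0 hr1 (hr i) hx hy
  have hlip : ∀ i, ∀ x ∈ Set.Ioo (-1 : ℝ) 1, ∀ y ∈ Set.Ioo (-1 : ℝ) 1,
      |logDenom (A i) x - logDenom (A i) y|
        ≤ 2 * (|projT (A i) 0| / (1 + √(1 - |projT (A i) 0| ^ 2)))
          * |Real.artanh x - Real.artanh y| := fun i x hx y hy => by
    rw [logDenom_eq (hpos i), logDenom_eq (hpos i)]
    exact abs_log_sub_log_le (abs_projT_zero_lt_one (hpos i)) (F_one_one_pos (hpos i)) hx hy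
  have hg : ∀ x ∈ Set.Ioo (-1 : ℝ) 1, ∀ y ∈ Set.Ioo (-1 : ℝ) 1,
      |(∑ i, w i * logDenom (A i) x) - ∑ i, w i * logDenom (A i) y|
        ≤ 2 * κ * |Real.artanh x - Real.artanh y| := fun x hx y hy => by
    rw [← Finset.sum_sub_distrib, hκ, Finset.mul_sum, Finset.sum_mul]
    refine (Finset.abs_sum_le_sum_abs _ _).trans (Finset.sum_le_sum fun i _ => ?_)
    rw [← mul_sub, abs_mul, abs_of_pos (hw i)]
    refine (mul_le_mul_of_nonneg_left (hlip i x hx y hy) (hw0 i)).trans_eq ?_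
    ring
  obtain ⟨lam, hlam⟩ := exists_limit_markovOp_iterate hw0 hw1 hr0.le hr1
    (by positivity : 0 ≤ 2 * κ) hf hcontr hg
  have h1r : 0 < 1 - r := by linarith
  -- The factor `2` of the Lipschitz constant is absorbed by `dHyp a 0 = 2 |artanh a|`.
  have hE : ∀ k, 2 * κ * (∑ i, w i * |Real.artanh (proj (A i) 0)|) * r ^ k / (1 - r)
      = tailConst A w r * r ^ k := by
    intro k
    have : ∀ i, dHyp (proj (A i) 0) 0 = 2 * |Real.artanh (proj (A i) 0)| := fun i =>
      dHyp_zero (hf i 0 (by simp))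
    simp only [tailConst, this]
    have e : ∑ i, w i * (2 * |Real.artanh (proj (A i) 0)|)
        = 2 * ∑ i, w i * |Real.artanh (proj (A i) 0)| := by
      rw [Finset.mul_sum]
      exact Finset.sum_congr rfl fun i _ => by ring
    rw [e, ← hκ]
    field_simp
  simp_rw [hE] at hlam
  refine ⟨lam, ?_, hlam⟩
  have hB : ∀ k, ∀ x, |x| ≤ r →
      |(markovOp w fun i => proj (A i))^[k] (fun x => ∑ i, w i * logDenom (A i) x) x - lam|
        ≤ (2 * κ * Real.artanh r + tailConst A w r) * r ^ k := by
    intro k x hx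
    have h1 := abs_markovOp_iterate_sub_le_artanh hw0 hw1 hr0.le (by positivity : 0 ≤ 2 * κ)
      hf hcontr hg k (hIoo hx) (show (0 : ℝ) ∈ Set.Ioo (-1 : ℝ) 1 by simp)
    rw [Real.artanh_zero, sub_zero] at h1
    have h2 : 2 * κ * r ^ k * |Real.artanh x| ≤ 2 * κ * r ^ k * Real.artanh r :=
      mul_le_mul_of_nonneg_left (abs_artanh_le hr1 hx) (by positivity)
    have h3 := abs_sub_le ((markovOp w fun i => proj (A i))^[k]
      (fun x => ∑ i, w i * logDenom (A i) x) x) ((markovOp w fun i => proj (A i))^[k]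
      (fun x => ∑ i, w i * logDenom (A i) x) 0) lam
    have h4 := hlam k
    rw [add_mul]
    linarith
  have hfr' : ∀ i, ∀ x, |x| ≤ r → |proj (A i) x| ≤ r := fun i x hx => hfr i x (hx.trans hr1.le)
  obtain ⟨h, hbd, hpoisson⟩ := exists_poisson_solution hr0.le hr1 hw1 hfr' hB
  -- Summing over the finite family is a crude substitute for its maximum.
  have hψ : ∀ i, ∀ x, |x| ≤ r → |logDenom (A i) x| ≤ ∑ j, (|logDenom (A j) 0|
      + 2 * (|projT (A j) 0| / (1 + √(1 - |projT (A j) 0| ^ 2))) * Real.artanh r) := by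
    intro i x hx
    have hnn : ∀ j, 0 ≤ |logDenom (A j) 0|
        + 2 * (|projT (A j) 0| / (1 + √(1 - |projT (A j) 0| ^ 2))) * Real.artanh r := fun j => by
      have := Real.artanh_nonneg hr0.le
      positivity
    refine le_trans ?_ (Finset.single_le_sum (fun j _ => hnn j) (Finset.mem_univ i))
    have h1 := hlip i x (hIoo hx) 0 (by simp)
    rw [Real.artanh_zero, sub_zero] at h1
    have h2 : 2 * (|projT (A i) 0| / (1 + √(1 - |projT (A i) 0| ^ 2))) * |Real.artanh x|
        ≤ 2 * (|projT (A i) 0| / (1 + √(1 - |projT (A i) 0| ^ 2))) * Real.artanh r :=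
      mul_le_mul_of_nonneg_left (abs_artanh_le hr1 hx) (by positivity)
    have h3 := abs_sub_abs_le_abs_sub (logDenom (A i) x) (logDenom (A i) 0)
    linarith
  have hae := ae_tendsto_average_orbit hw hw1 (f := fun i => proj (A i))
    (ψ := fun i => logDenom (A i)) hr0.le hfr' hψ hbd hpoisson
  unfold IsTopLyapunovExponent
  filter_upwards [hae] with ω hω
  have h2 := (tendsto_const_div_atTop_nhds_zero_nat (Real.log 2)).add hω
  rw [zero_add] at h2
  refine h2.congr fun n => ?_
  rw [log_entryNorm_matProd hpos]
  ring

end Exponent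

end KernelExpansion

theorem theorem4 {I : Type*} [Fintype I] [MeasurableSpace I] [DiscreteMeasurableSpace I]
    (A : I → Matrix (Fin 2) (Fin 2) ℝ)
    (hpos : ∀ i a b, 0 < A i a b) (hdet : ∀ i, (A i).det ≠ 0)
    (w : I → ℝ) (hw : ∀ i, 0 < w i) (hw1 : ∑ i, w i = 1)
    (r : ℝ) (hr0 : 0 < r) (hr1 : r < 1)
    (hr : ∀ i, Set.MapsTo (proj (A i)) (Set.Icc (-1) 1) (Set.Icc (-r) r)) :
    (0 ≤ maxT A ∧ maxT A < 1) ∧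
    (∃ lam : ℝ, IsTopLyapunovExponent A w hw hw1 lam ∧
      ∀ n m : ℕ, 2 ≤ n → 2 ≤ m →
        |lam - ∑ j ∈ Finset.range n,
            (applyMatrix (truncate (kernelMatrix A w) m))^[j] (initVec A w) 0|
          ≤ tailConst A w r * r ^ (n - 1)
            + 2 * Real.log (1 / (1 - r * maxT A)) *
              (((1 + r ^ (m - 1) * kernelConst r) ^ (n - 1) - 1
                  - ((n : ℝ) - 1) * (r ^ (m - 1) * kernelConst r))
                / (r ^ (m - 1) * kernelConst r))
            + 2 * ((n : ℝ) - 1) * r ^ m * maxT A ^ m / ((m : ℝ) * (1 - r * maxT A))) ∧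
    (0 < kernelConst r ∧
      kernelConst r ≤ min (r / √(1 - r ^ 2))
        (2 * r / (Real.pi * (1 + r)) * (Real.pi / 2 + Real.log ((1 + r) / (1 - r))))) := by
  have hne : Nonempty I := by
    by_contra h
    rw [not_nonempty_iff] at h
    simp at hw1
  have hC0 := maxT_nonneg (A := A)
  have hC1 := maxT_lt_one hpos
  have hrC : r * maxT A < 1 := by nlinarith
  have hK := kernelConst_pos hr0 hr1
  refine ⟨⟨hC0, hC1⟩, ?_, hK, le_min (kernelConst_le_sqrt hr0 hr1) (kernelConst_le_log hr0 hr1)⟩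
  obtain ⟨lam, hlam, hbound⟩ := exists_isTopLyapunovExponent hpos hw hw1 hr0 hr1 hr
  refine ⟨lam, hlam, fun n m hn hm => ?_⟩
  obtain ⟨N, rfl⟩ : ∃ N, n = N + 2 := ⟨n - 2, by lia⟩
  have h1 := hbound (N + 1)
  have h2 := abs_markovOp_iterate_sub_truncated_sum_le hpos hdet (fun i => (hw i).le) hw1 hr0 hr1 hr
    (by lia : 1 ≤ m) hrC N
  have hρ : 0 < r ^ (m - 1) * kernelConst r := by positivity
  have hL : 0 ≤ Real.log (1 / (1 - r * maxT A)) := by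
    refine Real.log_nonneg ?_
    rw [le_div_iff₀ (by linarith)]
    nlinarith
  have hpow : 0 ≤ (1 + r ^ (m - 1) * kernelConst r) ^ N - 1 :=
    sub_nonneg.2 (one_le_pow₀ (by linarith))
  -- Telescoping leaves a single truncation error, while the claimed bound allows for the sum of all
  -- of them, doubled. Both `h3` and `h4` give away this slack.
  have h3 : Real.log (1 / (1 - r * maxT A)) * ((1 + r ^ (m - 1) * kernelConst r) ^ N - 1)
      ≤ 2 * Real.log (1 / (1 - r * maxT A)) *
        (((1 + r ^ (m - 1) * kernelConst r) ^ (N + 1) - 1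
          - ((N : ℝ) + 1) * (r ^ (m - 1) * kernelConst r)) / (r ^ (m - 1) * kernelConst r)) :=
    mul_le_mul (by linarith) (pow_sub_one_le_div hρ N) hpow (by linarith)
  have h4 : (r * maxT A) ^ m / (m * (1 - r * maxT A))
      ≤ 2 * ((N : ℝ) + 1) * r ^ m * maxT A ^ m / ((m : ℝ) * (1 - r * maxT A)) := by
    have h5 : 0 < 1 - r * maxT A := by linarith
    rw [mul_assoc _ (r ^ m), ← mul_pow]
    gcongr
    exact le_mul_of_one_le_left (by positivity) (by linarith [Nat.cast_nonneg (α := ℝ) N])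
  have e : (((N + 2 : ℕ) : ℝ) - 1) = (N : ℝ) + 1 := by push_cast; ring
  rw [e, show N + 2 - 1 = N + 1 by lia]
  rw [abs_sub_comm] at h1
  exact (abs_sub_le _ _ _).trans
    ((add_le_add h1 (h2.trans (add_le_add h3 h4))).trans_eq (add_assoc _ _ _).symm)
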